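/- Let $\mathbb K$ be a field of characteristic $0$. A Lie triple system is a $\mathbb K$-vector space $L$ with a trilinear bracket $\pi=[\cdot,\cdot,\cdot]:L^3\to L$ such that $[x,x,y]=0$, $[x,y,z]+[y,z,x]+[z,x,y]=0$ and $[x,y,[z,t,e]]=[[x,y,z],t,e]+[z,[x,y,t],e]+[z,t,[x,y,e]]$. A representation of $L$ on a vector space $M$ is a bilinear map $\theta:L\times L\to \mathrm{End}(M)$ such that, with $D(x,y)=\theta(y,x)-\theta(x,y)$, $$\theta(z,t)\theta(x,y)-\theta(y,t)\theta(x,z)-\theta(x,[y,z,t])+D(y,z)\theta(x,t)=0,$$ $$\theta(z,t)D(x,y)-D(x,y)\theta(z,t)+\theta([x,y,z],t)+\theta(z,[x,y,t])=0.$$ A $3$-cocycle is a trilinear map $\mathcal H:L^3\to M$ such that $\mathcal H(x,x,y)=0$, $\mathcal H(x,y,z)+\mathcal H(y,z,x)+\mathcal H(z,x,y)=0$ and $$\mathcal H(x_1,x_2,[y_1,y_2,y_3])+D(x_1,x_2)\mathcal H(y_1,y_2,y_3)-\mathcal H([x_1,x_2,y_1],y_2,y_3)-\mathcal H(y_1,[x_1,x_2,y_2],y_3)$$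 $$=\mathcal H(y_1,y_2,[x_1,x_2,y_3])+\theta(y_2,y_3)\mathcal H(x_1,x_2,y_1)-\theta(y_1,y_3)\mathcal H(x_1,x_2,y_2)+D(y_1,y_2)\mathcal H(x_1,x_2,y_3).$$ For vector spaces $V,W$ and $n\ge 0$ let $C^n(V,W)$ be the space of linear maps $f:(\wedge^2V)^{\otimes n}\otimes V\to W$ which, if $n\ge1$, satisfy $f(\mathfrak X_1,\dots,\mathfrak X_{n-1},x,y,z)+f(\mathfrak X_1,\dots,\mathfrak X_{n-1},y,z,x)+f(\mathfrak X_1,\dots,\mathfrak X_{n-1},z,x,y)=0$. For $P\in C^p(V,V)$ and $Q\in C^q(V,V)$ put $[P,Q]=P\circ Q-(-1)^{pq}Q\circ P$, where, for $\mathfrak X_i=x_i\wedge y_i$, $$(P\circ Q)(\mathfrak X_1,\dots,\mathfrak X_{p+q},x)=\sum_{k=1}^p(-1)^{(k-1)q}\sum_{\sigma\in S(k-1,q)}(-1)^\sigma\Big(P(\mathfrak X_{\sigma(1)},\dots,\mathfrak X_{\sigma(k-1)},Q(\mathfrak X_{\sigma(k)},\dots,\mathfrak X_{\sigma(k+q-1)},x_{k+q})\wedge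 y_{k+q},\mathfrak X_{k+q+1},\dots,\mathfrak X_{p+q},x)$$ $$+P(\mathfrak X_{\sigma(1)},\dots,\mathfrak X_{\sigma(k-1)},x_{k+q}\wedge Q(\mathfrak X_{\sigma(k)},\dots,\mathfrak X_{\sigma(k+q-1)},y_{k+q}),\mathfrak X_{k+q+1},\dots,\mathfrak X_{p+q},x)\Big)$$ $$+(-1)^{pq}\sum_{\sigma\in S(p,q)}(-1)^\sigma P(\mathfrak X_{\sigma(1)},\dots,\mathfrak X_{\sigma(p)},Q(\mathfrak X_{\sigma(p+1)},\dots,\mathfrak X_{\sigma(p+q)},x)),$$ and $S(i,j)$ is the set of $(i,j)$-shuffles. An $L_\infty$-algebra is a $\mathbb Z$-graded vector space $\mathfrak g$ with multilinear maps $l_k:\mathfrak g^k\to\mathfrak g$ $(k\ge1)$ of degree $1$ such that for all $n\ge1$ and all homogeneous $x_1,\dots,x_n$, with Koszul signs $\varepsilon(\sigma)$, one has $l_n(x_{\sigma(1)},\dots,x_{\sigma(n)})=\varepsilon(\sigma)\,l_n(x_1,\dots,x_n)$ for every permutation $\sigma$, and $$\sum_{i=1}^n\sum_{\sigma\in S(i,n-i)}\varepsilon(\sigma)\,l_{n-i+1}(l_i(x_{\sigma(1)},\dots,x_{\sigma(i)}),x_{\sigma(i+1)},\dots,x_{\sigma(n)})=0.$$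 **Proposition.** Let $(L,\pi)$ be a Lie triple system over $\mathbb K$, $\theta$ a representation of $L$ on $M$, and $\mathcal H$ a $3$-cocycle. Let $\pi+\theta$ and $\mathcal H$ also denote the elements $$(x+u,\,y+v,\,z+w)\mapsto[x,y,z]+\theta(y,z)u-\theta(x,z)v+D(x,y)w\quad\text{and}\quad (x+u,\,y+v,\,z+w)\mapsto\mathcal H(x,y,z)$$ of $C^1(L\oplus M,L\oplus M)$, and regard $C^n(M,L)$ as a subspace of $C^n(L\oplus M,L\oplus M)$ (project all arguments to $M$, include the value into $L\oplus M$). Then for $P\in C^p(M,L)$, $Q\in C^q(M,L)$, $R\in C^r(M,L)$, $S\in C^s(M,L)$ the elements $$l_3(P,Q,R)=[[[\pi+\theta,P],Q],R],\qquad l_4(P,Q,R,S)=[[[[\mathcal H,P],Q],R],S]$$ lie in $C^{p+q+r+1}(M,L)$ and $C^{p+q+r+s+1}(M,L)$ respectively, and the graded vector space $C^*(M,L)=\bigoplus_{n\ge0}C^n(M,L)$ (with $C^n(M,L)$ in degree $n$), with $l_1=l_2=0$, the multilinear extensions of $l_3$ and $l_4$ to $C^*(M,L)$, and $l_k=0$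 for $k\ge5$, is an $L_\infty$-algebra. -/

import Mathlib

open scoped DirectSum

/-- The three axioms of a Lie triple system for a trilinear bracket on `L`; the first one says that
the bracket factors through `⋀² L ⊗ L`. -/
structure IsLieTripleSystem {K L : Type*} [Field K] [AddCommGroup L] [Module K L]
    (br : L →ₗ[K] L →ₗ[K] L →ₗ[K] L) : Prop where
  alternating : ∀ x y, br x x y = 0
  cyclic : ∀ x y z, br x y z + br y z x + br z x y = 0
  derivation : ∀ x y z t e,
    br x y (br z t e) = br (br x y z) t e + br z (br x y t) e + br z t (br x y e)

/-- The operator `D(x, y) = θ(y, x) - θ(x, y)` attached to `θ : L ⊗ L → End(M)`. -/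
def ltsD {K L M : Type*} [Field K] [AddCommGroup L] [Module K L] [AddCommGroup M] [Module K M]
    (θ : L →ₗ[K] L →ₗ[K] Module.End K M) (x y : L) : Module.End K M :=
  θ y x - θ x y

/-- `θ` is a representation on `M` of the Lie triple system `(L, br)`. Products are compositions of
endomorphisms of `M`. -/
structure IsLTSRepresentation {K L M : Type*} [Field K] [AddCommGroup L] [Module K L]
    [AddCommGroup M] [Module K M] (br : L →ₗ[K] L →ₗ[K] L →ₗ[K] L)
    (θ : L →ₗ[K] L →ₗ[K] Module.End K M) : Prop where
  rep_mul : ∀ x y z t,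
    θ z t * θ x y - θ y t * θ x z - θ x (br y z t) + ltsD θ y z * θ x t = 0
  rep_comm : ∀ x y z t,
    θ z t * ltsD θ x y - ltsD θ x y * θ z t + θ (br x y z) t + θ z (br x y t) = 0

/-- `H` is a (Yamaguti) 3-cocycle of `(L, br)` with coefficients in `(M, θ)`. -/
structure IsLTSThreeCocycle {K L M : Type*} [Field K] [AddCommGroup L] [Module K L]
    [AddCommGroup M] [Module K M] (br : L →ₗ[K] L →ₗ[K] L →ₗ[K] L)
    (θ : L →ₗ[K] L →ₗ[K] Module.End K M) (H : L →ₗ[K] L →ₗ[K] L →ₗ[K] M) : Prop where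
  alternating : ∀ x y, H x x y = 0
  cyclic : ∀ x y z, H x y z + H y z x + H z x y = 0
  cocycle : ∀ x₁ x₂ y₁ y₂ y₃,
    H x₁ x₂ (br y₁ y₂ y₃) + ltsD θ x₁ x₂ (H y₁ y₂ y₃)
        - H (br x₁ x₂ y₁) y₂ y₃ - H y₁ (br x₁ x₂ y₂) y₃
      = H y₁ y₂ (br x₁ x₂ y₃) + θ y₂ y₃ (H x₁ x₂ y₁) - θ y₁ y₃ (H x₁ x₂ y₂)
        + ltsD θ y₁ y₂ (H x₁ x₂ y₃)

/-- Functions of `n` pairs of vectors of `V` and of one more vector of `V`, with values in `W`. -/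
abbrev PairFun (n : ℕ) (V W : Type*) := (Fin n → V × V) → V → W

/-- The space `Cⁿ(V, W)` of linear maps `(⋀² V)^{⊗ n} ⊗ V → W`, written as functions of `n` pairs
and one vector that are linear in all `2 n + 1` entries and alternating in each pair, whose cyclic
sum over the last three entries vanishes. -/
def LTSCochain (K : Type*) (n : ℕ) (V W : Type*) [Field K] [AddCommGroup V] [Module K V]
    [AddCommGroup W] [Module K W] : Submodule K (PairFun n V W) where
  carrier := { f |
    (∀ X, IsLinearMap K (fun z => f X z)) ∧
    (∀ X i y z, IsLinearMap K (fun x => f (Function.update X i (x, y)) z)) ∧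
    (∀ X i x z, IsLinearMap K (fun y => f (Function.update X i (x, y)) z)) ∧
    (∀ X i x z, f (Function.update X i (x, x)) z = 0) ∧
    (∀ X (i : Fin n), (i : ℕ) + 1 = n → ∀ x y z,
      f (Function.update X i (x, y)) z + f (Function.update X i (y, z)) x
        + f (Function.update X i (z, x)) y = 0) }
  zero_mem' := by
    refine ⟨fun _ => ⟨?_, ?_⟩, fun _ _ _ _ => ⟨?_, ?_⟩, fun _ _ _ _ => ⟨?_, ?_⟩, ?_, ?_⟩ <;> simp
  add_mem' := by
    rintro f g ⟨f1, f2, f3, f4, f5⟩ ⟨g1, g2, g3, g4, g5⟩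
    refine ⟨fun X => ((f1 X).mk' _ + (g1 X).mk' _).isLinear,
      fun X i y z => ((f2 X i y z).mk' _ + (g2 X i y z).mk' _).isLinear,
      fun X i x z => ((f3 X i x z).mk' _ + (g3 X i x z).mk' _).isLinear,
      fun X i x z => ?_, fun X i hi x y z => ?_⟩
    · simp [f4, g4]
    · have h1 := f5 X i hi x y z
      have h2 := g5 X i hi x y z
      simp only [Pi.add_apply]
      rw [← add_zero (0 : W)]
      nth_rewrite 1 [← h1]
      rw [← h2]
      abel
  smul_mem' := by
    rintro c f ⟨f1, f2, f3, f4, f5⟩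
    refine ⟨fun X => (c • (f1 X).mk' _).isLinear,
      fun X i y z => (c • (f2 X i y z).mk' _).isLinear,
      fun X i x z => (c • (f3 X i x z).mk' _).isLinear,
      fun X i x z => ?_, fun X i hi x y z => ?_⟩
    · simp [f4]
    · simp only [Pi.smul_apply, ← smul_add, f5 X i hi x y z, smul_zero]

/-- `σ` is an `(i, n - i)`-shuffle: it increases on the first `i` indices and on the others. -/
def IsShuffle {n : ℕ} (i : ℕ) (σ : Equiv.Perm (Fin n)) : Prop :=
  ∀ a b : Fin n, a < b → ((b : ℕ) < i ∨ i ≤ (a : ℕ)) → σ a < σ b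

instance {n : ℕ} (i : ℕ) : DecidablePred (IsShuffle (n := n) i) :=
  fun σ => inferInstanceAs
    (Decidable (∀ a b : Fin n, a < b → ((b : ℕ) < i ∨ i ≤ (a : ℕ)) → σ a < σ b))

/-- The list of pairs `X_{σ(1)}, …, X_{σ(k-1)}, v, X_{k+q+1}, …, X_{p+q}`, where `k = j + 1` and
`n = p + q`; the indices in the code start at `0`. -/
def ltsInsert {V : Type*} {p q n : ℕ} (h : p + q = n) (X : Fin n → V × V) (j : Fin p)
    (σ : Equiv.Perm (Fin ((j : ℕ) + q))) (v : V × V) : Fin p → V × V :=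
  fun a =>
    if ha : a < j then X (Fin.castLE (by omega) (σ ⟨a, by omega⟩))
    else if a = j then v
    else X ⟨(a : ℕ) + q, by omega⟩

/-- The circle product `P ∘ Q` of a cochain `P` of degree `p` and a cochain `Q` of degree `q`. -/
def ltsCirc {V : Type*} [AddCommGroup V] {p q n : ℕ} (h : p + q = n)
    (P : PairFun p V V) (Q : PairFun q V V) : PairFun n V V :=
  fun X x =>
    (∑ j : Fin p, (-1 : ℤ) ^ ((j : ℕ) * q) •
      ∑ σ : Equiv.Perm (Fin ((j : ℕ) + q)) with IsShuffle (j : ℕ) σ,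
        (Equiv.Perm.sign σ : ℤ) •
          (let A : V → V :=
            Q (fun b => X (Fin.castLE (by omega) (σ (Fin.natAdd (j : ℕ) b))))
          let Y : V × V := X ⟨(j : ℕ) + q, by omega⟩
          P (ltsInsert h X j σ (A Y.1, Y.2)) x + P (ltsInsert h X j σ (Y.1, A Y.2)) x))
    + (-1 : ℤ) ^ (p * q) •
      ∑ σ : Equiv.Perm (Fin (p + q)) with IsShuffle p σ,
        (Equiv.Perm.sign σ : ℤ) •
          P (fun a => X (Fin.cast h (σ (Fin.castAdd q a))))
            (Q (fun b => X (Fin.cast h (σ (Fin.natAdd p b)))) x)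

/-- The bracket `[P, Q] = P ∘ Q - (-1)^{pq} Q ∘ P`. -/
def ltsBracket {V : Type*} [AddCommGroup V] {p q : ℕ}
    (P : PairFun p V V) (Q : PairFun q V V) : PairFun (p + q) V V :=
  ltsCirc rfl P Q - (-1 : ℤ) ^ (p * q) • ltsCirc (Nat.add_comm q p) Q P

/-- A map `f` on `M` with values in `L`, regarded as a map on `L ⊕ M` with values in `L ⊕ M`
(all entries are projected to `M`, the value is included into `L ⊕ M`). -/
def ltsLift {L M : Type*} [AddCommGroup M] {n : ℕ} (f : PairFun n M L) :
    PairFun n (L × M) (L × M) :=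
  fun X w => (f (fun i => ((X i).1.2, (X i).2.2)) w.2, 0)

/-- `π + θ`, the degree one cochain on `L ⊕ M` given by the semidirect product
`[x + u, y + v, z + w] = [x, y, z] + θ(y, z) u - θ(x, z) v + D(x, y) w`. -/
def ltsSemidirect {K L M : Type*} [Field K] [AddCommGroup L] [Module K L]
    [AddCommGroup M] [Module K M] (br : L →ₗ[K] L →ₗ[K] L →ₗ[K] L)
    (θ : L →ₗ[K] L →ₗ[K] Module.End K M) : PairFun 1 (L × M) (L × M) :=
  fun X c =>
    let a := (X 0).1
    let b := (X 0).2
    (br a.1 b.1 c.1, θ b.1 c.1 a.2 - θ a.1 c.1 b.2 + ltsD θ a.1 b.1 c.2)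

/-- `H`, regarded as a degree one cochain on `L ⊕ M`. -/
def ltsTwist {K L M : Type*} [Field K] [AddCommGroup L] [Module K L]
    [AddCommGroup M] [Module K M] (H : L →ₗ[K] L →ₗ[K] L →ₗ[K] M) :
    PairFun 1 (L × M) (L × M) :=
  fun X c => (0, H (X 0).1.1 (X 0).2.1 c.1)

/-- The Koszul sign `ε(σ)`: the sign with
`x_{σ(1)} ⊙ ⋯ ⊙ x_{σ(n)} = ε(σ) x_1 ⊙ ⋯ ⊙ x_n` for homogeneous `x_i` of degree `d i`. -/
def koszulSign {n : ℕ} (d : Fin n → ℤ) (σ : Equiv.Perm (Fin n)) : ℤˣ :=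
  ∏ ab : Fin n × Fin n with ab.1 < ab.2 ∧ σ ab.2 < σ ab.1,
    (-1 : ℤˣ) ^ (d (σ ab.1) * d (σ ab.2))

/-- The operations `l k` (`k ≥ 1`; the value `l 0` plays no role) make the `ℤ`-graded vector space
`V = ⨁ 𝒜 k` into an `L_∞`-algebra, in the convention in which the operations are graded symmetric
of degree `1`. In `jacobi` the sum runs over `i + 1 = 1, …, n`. -/
structure IsLInfinityAlgebra (K V : Type*) [Field K] [AddCommGroup V] [Module K V]
    (𝒜 : ℤ → Submodule K V) (l : ∀ k : ℕ, MultilinearMap K (fun _ : Fin k => V) V) : Prop where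
  graded : DirectSum.IsInternal 𝒜
  degree_one : ∀ (n : ℕ), 1 ≤ n → ∀ (d : Fin n → ℤ) (x : Fin n → V), (∀ i, x i ∈ 𝒜 (d i)) →
    l n x ∈ 𝒜 (∑ i, d i + 1)
  graded_symm : ∀ (n : ℕ), 1 ≤ n → ∀ (d : Fin n → ℤ) (x : Fin n → V), (∀ i, x i ∈ 𝒜 (d i)) →
    ∀ σ : Equiv.Perm (Fin n), l n (fun i => x (σ i)) = (koszulSign d σ : ℤ) • l n x
  jacobi : ∀ (n : ℕ), 1 ≤ n → ∀ (d : Fin n → ℤ) (x : Fin n → V), (∀ i, x i ∈ 𝒜 (d i)) →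
    ∑ i : Fin n, ∑ σ : Equiv.Perm (Fin n) with IsShuffle ((i : ℕ) + 1) σ,
      (koszulSign d σ : ℤ) •
        l (n - ((i : ℕ) + 1) + 1)
          (Fin.cons (l ((i : ℕ) + 1) (fun a => x (σ (Fin.castLE (by omega) a))))
            (fun b : Fin (n - ((i : ℕ) + 1)) => x (σ ⟨(i : ℕ) + 1 + (b : ℕ), by omega⟩))) = 0

/-- The space `C^*(M, L) = ⨁_{n ≥ 0} Cⁿ(M, L)`. -/
abbrev LTSCochainSpace (K M L : Type*) [Field K] [AddCommGroup L] [Module K L]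
    [AddCommGroup M] [Module K M] :=
  ⨁ n : ℕ, LTSCochain K n M L

/-- An element of `Cⁿ(M, L)` as an element of `C^*(M, L)`. -/
noncomputable def ltsOf {K M L : Type*} [Field K] [AddCommGroup L] [Module K L]
    [AddCommGroup M] [Module K M] {n : ℕ} (f : LTSCochain K n M L) : LTSCochainSpace K M L :=
  DirectSum.lof K ℕ (fun n => LTSCochain K n M L) n f

/-- The `ℤ`-grading of `C^*(M, L)`: degree `n` is `Cⁿ(M, L)` for `n ≥ 0`, and `0` for `n < 0`. -/
def ltsGrading (K M L : Type*) [Field K] [AddCommGroup L] [Module K L]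
    [AddCommGroup M] [Module K M] (k : ℤ) : Submodule K (LTSCochainSpace K M L) where
  carrier := { x | ∀ n : ℕ, (n : ℤ) ≠ k → x n = 0 }
  zero_mem' := fun _ _ => rfl
  add_mem' := by
    intro x y hx hy n hn
    rw [DirectSum.add_apply, hx n hn, hy n hn, add_zero]
  smul_mem' := by
    intro c x hx n hn
    rw [DirectSum.smul_apply, hx n hn, smul_zero]

set_option linter.unusedSectionVars false

/-! This is the construction of higher derived brackets inside the graded Lie algebra of cochains of
`L ⊕ M`.

Give a multilinear component of a cochain of `L ⊕ M` the weight "number of entries in `L`, minus one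
if the value is in `L`". Weight is additive under insertion. The space `fil e` collects the cochains
of weight at most `e - 1`, so `bra_mem_fil` sends `fil e` and `fil e'` to `fil (e + e' - 1)`, and
`fil e = 0` for `e < 0`. The homogeneous elements of `fil 0` are those of `C^*(M, L)`; they commute
because their brackets lie in `fil (-1)`. Since `π + θ` is in `fil 3` and `H` in `fil 4`, bracketing
them with three, respectively four, elements of `C^*(M, L)` gives an element of `C^*(M, L)`, and one
bracket more gives zero. Graded symmetry of the operations is the Jacobi identity together with
commutativity of `C^*(M, L)` (`iter_swap`).

The hypotheses enter only through three equations: `[π + θ, π + θ] = 0` (Lie triple system and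
representation), `[π + θ, H] = 0` (cocycle) and `[H, H] = 0` (trivial). Expanding the iterated
bracket of `[Δ, Δ'] = 0` with elements of `C^*(M, L)` by the Leibniz rule, the weight leaves only
the terms of the `L_∞` identity (`jacobi_of_bra_eq_zero`).

The remaining work is that the circle product is graded pre-Lie (`circ_prelie`). Cochains are
functions of lists of pairs, with the last pair at the head, which makes `circ` recursive. A
function of `X :: w` is a function of `w` whose values are antisymmetric bilinear functions of `X`,
and insertion at `X` is an action of endomorphisms on those values. Hence the commutator formula for
insertions follows by induction on the list, for all value spaces at once (`der_comm`). All signs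
come from cocommutativity and coassociativity of the splitting sum `ksplit`; `sum_isShuffle`
identifies this sum with the shuffle sums of the statement. -/

/-- The sign `(-1)ⁿ` as a unit of `ℤ`. -/
def sg (n : ℤ) : ℤˣ := (-1) ^ n

theorem sg_add (m n : ℤ) : sg (m + n) = sg m * sg n := zpow_add _ _ _

theorem sg_zero : sg 0 = 1 := rfl

theorem sg_one : sg 1 = -1 := rfl

theorem sg_mul_self (n : ℤ) : sg n * sg n = 1 := Int.units_mul_self _

theorem sg_smul_smul {U : Type*} [AddCommGroup U] (n : ℤ) (u : U) : sg n • sg n • u = u := by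
  rw [smul_smul, sg_mul_self, one_smul]

/-! ### Koszul-signed sums over splittings of a list -/

/-- Total degree of a list of letters. -/
def degSum {G : Type*} (d : G → ℤ) (w : List G) : ℤ := (w.map d).sum

@[simp] theorem degSum_nil {G : Type*} (d : G → ℤ) : degSum d [] = 0 := rfl

@[simp] theorem degSum_cons {G : Type*} (d : G → ℤ) (X : G) (w : List G) :
    degSum d (X :: w) = d X + degSum d w := by simp [degSum]

theorem degSum_append {G : Type*} (d : G → ℤ) (u w : List G) :
    degSum d (u ++ w) = degSum d u + degSum d w := by simp [degSum]

theorem degSum_perm {G : Type*} (d : G → ℤ) {u w : List G} (h : u.Perm w) :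
    degSum d u = degSum d w := (h.map d).sum_eq

@[simp] theorem degSum_one {G : Type*} (w : List G) :
    degSum (fun _ : G => (1 : ℤ)) w = w.length := by
  induction w with
  | nil => rfl
  | cons X w ih => rw [degSum_cons, ih]; push_cast [List.length_cons]; ring

/-- Sum of `φ a b` over all ways of splitting a list into two complementary sublists `a`, `b`,
weighted by the Koszul sign of the corresponding unshuffle. Lists are read from right to left. -/
def ksplit {G U : Type*} [AddCommGroup U] (d : G → ℤ) :
    (List G → List G → U) → List G → U
  | φ, [] => φ [] []
  | φ, X :: w => ksplit d (fun a b => φ a (X :: b)) w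
      + ksplit d (fun a b => sg (d X * degSum d b) • φ (X :: a) b) w

section ksplit
variable {G U W : Type*} [AddCommGroup U] [AddCommGroup W] (d : G → ℤ)

/-- The two sublists together rearrange `w`; this is how lengths and degrees of `a` and `b` become
comparable with those of `w`. -/
theorem ksplit_congr {φ ψ : List G → List G → U} {w : List G}
    (h : ∀ a b, (a ++ b).Perm w → φ a b = ψ a b) : ksplit d φ w = ksplit d ψ w := by
  induction w generalizing φ ψ with
  | nil => exact h [] [] (List.Perm.refl _)
  | cons X w ih =>
    simp only [ksplit]
    rw [ih (fun a b hab => h a (X :: b) (List.perm_middle.trans (hab.cons X))),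
      ih (fun a b hab => congrArg _ (h (X :: a) b (hab.cons X)))]

theorem ksplit_map (f : U →+ W) (φ : List G → List G → U) (w : List G) :
    f (ksplit d φ w) = ksplit d (fun a b => f (φ a b)) w := by
  induction w generalizing φ with
  | nil => rfl
  | cons X w ih => simp only [ksplit, map_add, ih, Units.smul_def, map_zsmul]

theorem ksplit_add (φ ψ : List G → List G → U) (w : List G) :
    ksplit d (fun a b => φ a b + ψ a b) w = ksplit d φ w + ksplit d ψ w := by
  induction w generalizing φ ψ with
  | nil => rfl
  | cons X w ih => simp only [ksplit, smul_add, ih]; abel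

theorem ksplit_smul {S : Type*} [Monoid S] [DistribMulAction S U] (c : S)
    (φ : List G → List G → U) (w : List G) :
    ksplit d (fun a b => c • φ a b) w = c • ksplit d φ w :=
  (ksplit_map d (DistribSMul.toAddMonoidHom U c) φ w).symm

theorem ksplit_neg (φ : List G → List G → U) (w : List G) :
    ksplit d (fun a b => -φ a b) w = -ksplit d φ w :=
  (ksplit_map d (-AddMonoidHom.id U) φ w).symm

theorem ksplit_sub (φ ψ : List G → List G → U) (w : List G) :
    ksplit d (fun a b => φ a b - ψ a b) w = ksplit d φ w - ksplit d ψ w := by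
  simp only [sub_eq_add_neg, ksplit_add, ksplit_neg]

theorem ksplit_zero (w : List G) : ksplit d (fun _ _ => (0 : U)) w = 0 := by
  induction w with
  | nil => rfl
  | cons X w ih => simp only [ksplit, smul_zero, ih, add_zero]

theorem ksplit_eq_zero {φ : List G → List G → U} {w : List G}
    (h : ∀ a b, (a ++ b).Perm w → φ a b = 0) : ksplit d φ w = 0 :=
  (ksplit_congr d h).trans (ksplit_zero d w)

/-- Cocommutativity of the unshuffle coproduct: exchanging the two blocks costs the sign of the
product of their degrees. -/
theorem ksplit_comm (φ : List G → List G → U) (w : List G) :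
    ksplit d φ w = ksplit d (fun a b => sg (degSum d a * degSum d b) • φ b a) w := by
  induction w generalizing φ with
  | nil => simp [ksplit, sg_zero]
  | cons X w ih =>
    simp only [ksplit]
    rw [add_comm, ih fun a b => φ a (X :: b), ih fun a b => sg (d X * degSum d b) • φ (X :: a) b]
    congr 1
    · refine ksplit_congr d fun a b _ => ?_
      rw [smul_smul, degSum_cons, mul_add, sg_add, mul_comm (d X), mul_comm (sg _)]
    · refine ksplit_congr d fun a b _ => ?_
      rw [smul_smul, degSum_cons, add_mul, sg_add, ← mul_assoc, sg_mul_self, one_mul]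

/-- Coassociativity: both sides run over the splittings into three sublists, with the same sign. -/
theorem ksplit_assoc (φ : List G → List G → List G → U) (w : List G) :
    ksplit d (fun a e => ksplit d (fun b c => φ a b c) e) w
      = ksplit d (fun f c => ksplit d (fun a b => φ a b c) f) w := by
  induction w generalizing φ with
  | nil => rfl
  | cons X w ih =>
    simp only [ksplit]
    rw [ksplit_add, ih, ih]
    have h3 : ksplit d (fun a b => sg (d X * degSum d b) • ksplit d (fun b c => φ (X :: a) b c) b) w
        = ksplit d (fun a e => ksplit d (fun b c =>
            sg (d X * degSum d b) • sg (d X * degSum d c) • φ (X :: a) b c) e) w := by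
      refine ksplit_congr d fun a e _ => ?_
      rw [← ksplit_smul]
      refine ksplit_congr d fun b c hbc => ?_
      rw [← degSum_perm d hbc, degSum_append, mul_add, sg_add, mul_smul]
    have h4 : ksplit d (fun f c => sg (d X * degSum d c) •
          (ksplit d (fun a b => φ a (X :: b) c) f
            + ksplit d (fun a b => sg (d X * degSum d b) • φ (X :: a) b c) f)) w
        = ksplit d (fun f c => ksplit d (fun a b =>
            sg (d X * degSum d c) • φ a (X :: b) c) f) w
          + ksplit d (fun f c => ksplit d (fun a b =>
            sg (d X * degSum d b) • sg (d X * degSum d c) • φ (X :: a) b c) f) w := by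
      rw [← ksplit_add]
      refine ksplit_congr d fun f c _ => ?_
      rw [smul_add, ← ksplit_smul, ← ksplit_smul]
      congr 1
      refine ksplit_congr d fun a b _ => ?_
      rw [smul_comm]
    rw [h3, h4, ih]
    abel

end ksplit

/-- The graded shuffle sum for letters of degree one. -/
abbrev sh {G U : Type*} [AddCommGroup U] (φ : List G → List G → U) : List G → U :=
  ksplit (fun _ => 1) φ

theorem sh_cons {G U : Type*} [AddCommGroup U] (φ : List G → List G → U) (X : G) (w : List G) :
    sh φ (X :: w) = sh (fun a b => φ a (X :: b)) w
      + sh (fun a b => sg b.length • φ (X :: a) b) w := by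
  simp [ksplit]

/-! ### Functions antisymmetric in pairs, and insertion of a cochain into them -/

/-- The functions of two variables that are bilinear and antisymmetric. -/
def altBil (K V U : Type*) [Field K] [AddCommGroup V] [Module K V] [AddCommGroup U] [Module K U] :
    Submodule K (V × V → U) where
  carrier := {f | (∀ x x' y, f (x + x', y) = f (x, y) + f (x', y)) ∧
    (∀ (c : K) x y, f (c • x, y) = c • f (x, y)) ∧ ∀ x y, f (x, y) = -f (y, x)}
  zero_mem' := by simp
  add_mem' := by
    rintro f g ⟨f1, f2, f3⟩ ⟨g1, g2, g3⟩
    refine ⟨fun x x' y => ?_, fun c x y => ?_, fun x y => ?_⟩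
    · simp only [Pi.add_apply, f1, g1]; abel
    · simp only [Pi.add_apply, f2, g2, smul_add]
    · simp only [Pi.add_apply]; rw [f3, g3]; abel
  smul_mem' := by
    rintro c f ⟨f1, f2, f3⟩
    refine ⟨fun x x' y => ?_, fun c' x y => ?_, fun x y => ?_⟩
    · simp only [Pi.smul_apply, f1, smul_add]
    · simp only [Pi.smul_apply, f2, smul_comm c]
    · simp only [Pi.smul_apply]; rw [f3, smul_neg]

section altBil
variable {K V U : Type*} [Field K] [AddCommGroup V] [Module K V] [AddCommGroup U] [Module K U]
  {f : V × V → U}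

theorem altBil_add_right (hf : f ∈ altBil K V U) (x y y' : V) :
    f (x, y + y') = f (x, y) + f (x, y') := by
  rw [hf.2.2, hf.1, hf.2.2 y, hf.2.2 y', neg_add, neg_neg, neg_neg]

theorem altBil_smul_right (hf : f ∈ altBil K V U) (c : K) (x y : V) :
    f (x, c • y) = c • f (x, y) := by
  rw [hf.2.2, hf.2.1, hf.2.2 y, smul_neg, neg_neg]

theorem altBil_zero_left (hf : f ∈ altBil K V U) (y : V) : f (0, y) = 0 := by
  simpa using hf.2.1 0 0 y

theorem altBil_zero_right (hf : f ∈ altBil K V U) (y : V) : f (y, 0) = 0 := by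
  rw [hf.2.2, altBil_zero_left hf, neg_zero]

/-- The action of an endomorphism of `V` on functions of a pair of vectors. -/
def act (A : Module.End K V) (φ : V × V → U) (X : V × V) : U := φ (A X.1, X.2) + φ (X.1, A X.2)

theorem act_mem (A : Module.End K V) (hf : f ∈ altBil K V U) : act A f ∈ altBil K V U := by
  refine ⟨fun x x' y => ?_, fun c x y => ?_, fun x y => ?_⟩
  · simp only [act, map_add, hf.1]; abel
  · simp only [act, map_smul, hf.2.1, smul_add]
  · simp only [act]; rw [hf.2.2, hf.2.2 x]; abel

variable (K V U) in
/-- The action of endomorphisms of `V` on antisymmetric bilinear functions. -/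
def actL : Module.End K V →ₗ[K] Module.End K (altBil K V U) where
  toFun A :=
    { toFun := fun f => ⟨act A f.1, act_mem A f.2⟩
      map_add' := fun f g => by ext X; simp [act]; abel
      map_smul' := fun c f => by ext X; simp [act] }
  map_add' A B := by
    ext f X
    simp only [act, LinearMap.add_apply, Submodule.coe_add, LinearMap.coe_mk, AddHom.coe_mk,
      Pi.add_apply]
    rw [f.2.1, altBil_add_right f.2]; abel
  map_smul' c A := by
    ext f X
    simp only [act, LinearMap.smul_apply, Submodule.coe_smul, LinearMap.coe_mk, AddHom.coe_mk,
      Pi.smul_apply, RingHom.id_apply]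
    rw [f.2.2.1, altBil_smul_right f.2, smul_add]

theorem actL_apply (A : Module.End K V) (φ : altBil K V U) (X : V × V) :
    (actL K V U A φ).1 X = act A φ.1 X := rfl

/-- Endomorphisms act by precomposition, so the action reverses products. Right multiplication on
`End V` obeys the same rule, and `rder_comm_of_der_comm` covers both cases. -/
theorem actL_bracket (A B : Module.End K V) (φ : altBil K V U) :
    actL K V U A (actL K V U B φ) - actL K V U B (actL K V U A φ)
      = actL K V U (B * A - A * B) φ := by
  rw [map_sub]
  ext X
  simp only [LinearMap.sub_apply, Submodule.coe_sub, Pi.sub_apply, actL_apply, act,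
    Module.End.mul_apply]
  abel

end altBil

/-- Functions of lists of pairs that are bilinear and antisymmetric in each pair. -/
def multi (K V U : Type*) [Field K] [AddCommGroup V] [Module K V] [AddCommGroup U] [Module K U] :
    Submodule K (List (V × V) → U) where
  carrier := {F | ∀ u v, (fun X => F (u ++ X :: v)) ∈ altBil K V U}
  zero_mem' := fun _ _ => (altBil K V U).zero_mem
  add_mem' := fun hf hg u v => (altBil K V U).add_mem (hf u v) (hg u v)
  smul_mem' := fun c _ hf u v => (altBil K V U).smul_mem c (hf u v)

/-- `F` vanishes on lists whose length is not `n`. -/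
def IsDeg {G U : Type*} [Zero U] (n : ℤ) (F : List G → U) : Prop :=
  ∀ w : List G, (w.length : ℤ) ≠ n → F w = 0

section der
variable {K V U W : Type*} [Field K] [AddCommGroup V] [Module K V] [AddCommGroup U] [Module K U]
  [AddCommGroup W] [Module K W]

theorem multi_cons {F : List (V × V) → U} (hF : F ∈ multi K V U) (X : V × V) :
    (fun w => F (X :: w)) ∈ multi K V U := fun u v => hF (X :: u) v

theorem multi_head {F : List (V × V) → U} (hF : F ∈ multi K V U) (w : List (V × V)) :
    (fun X => F (X :: w)) ∈ altBil K V U := hF [] w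

theorem multi_map (f : U →ₗ[K] W) {F : List (V × V) → U} (hF : F ∈ multi K V U) :
    (fun w => f (F w)) ∈ multi K V W := fun u v =>
  ⟨fun x x' y => by simp only [(hF u v).1 x x' y, map_add],
    fun c x y => by simp only [(hF u v).2.1 c x y, map_smul],
    fun x y => by simp only [(hF u v).2.2 x y, map_neg]⟩

theorem multi_sg_smul (s : List (V × V) → ℤˣ) (hs : ∀ u X Y v, s (u ++ X :: v) = s (u ++ Y :: v))
    {F : List (V × V) → U} (hF : F ∈ multi K V U) : (fun w => s w • F w) ∈ multi K V U :=
  fun u v =>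
  ⟨fun x x' y => by
    simp only [(hF u v).1 x x' y, smul_add]
    rw [hs u (x + x', y) (x, y), hs u (x', y) (x, y)],
    fun c x y => by
      simp only [(hF u v).2.1 c x y, smul_comm c]
      rw [hs u (c • x, y) (x, y)],
    fun x y => by
      have h := (hF u v).2.2 x y
      simp only at h ⊢
      rw [hs u (y, x) (x, y), h, smul_neg]⟩

theorem sh_mem_multi {φ : List (V × V) → List (V × V) → U}
    (h1 : ∀ b, (fun a => φ a b) ∈ multi K V U) (h2 : ∀ a, φ a ∈ multi K V U) :
    sh φ ∈ multi K V U := by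
  intro u v
  induction u generalizing φ with
  | nil =>
    have e : (fun X => sh φ ([] ++ X :: v)) = sh (fun a b X => φ a (X :: b)) v
        + sh (fun a b X => sg b.length • φ (X :: a) b) v := by
      funext X
      rw [List.nil_append, sh_cons, Pi.add_apply]
      have h := fun ψ : List (V × V) → List (V × V) → (V × V → U) =>
        ksplit_map (fun _ => 1) (Pi.evalAddMonoidHom (fun _ : V × V => U) X) ψ v
      exact congrArg₂ (· + ·) (h fun a b X => φ a (X :: b)).symm
        (h fun a b X => sg b.length • φ (X :: a) b).symm
    -- Regarded as functions of the free pair, the summands lie in the submodule `altBil`, hence so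
    -- does their signed sum.
    have key : ∀ ψ : List (V × V) → List (V × V) → (V × V → U),
        (∀ a b, ψ a b ∈ altBil K V U) → sh ψ v ∈ altBil K V U := by
      intro ψ hψ
      have h := ksplit_map (fun _ => 1) (altBil K V U).subtype.toAddMonoidHom
        (fun a b => ⟨ψ a b, hψ a b⟩) v
      exact (congrArg (· ∈ altBil K V U) h).mp (Subtype.property _)
    rw [e]
    refine add_mem (key _ fun a b => multi_head (h2 a) b) (key _ fun a b => ?_)
    have := (altBil K V U).smul_of_tower_mem (sg b.length : ℤ) (multi_head (h1 b) a)
    exact this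
  | cons Y u ih =>
    simp only [List.cons_append, sh_cons]
    refine add_mem (ih (φ := fun a b => φ a (Y :: b)) (fun b => h1 (Y :: b))
      (fun a => multi_cons (h2 a) Y)) (ih (φ := fun a b => sg b.length • φ (Y :: a) b) (fun b => ?_)
        (fun a => ?_))
    · exact multi_sg_smul (fun _ => sg b.length) (fun _ _ _ _ => rfl) (multi_cons (h1 b) Y)
    · exact multi_sg_smul (fun b => sg b.length) (fun _ _ _ _ => by simp) (h2 (Y :: a))

/-- The action of a cochain `Q` with values in `End V` on functions of lists of pairs, where `Q`
is inserted at all pairs of the list. -/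
def der (Q : List (V × V) → Module.End K V) : (List (V × V) → U) → List (V × V) → U
  | _, [] => 0
  | F, X :: w => der Q (fun u => F (X :: u)) w + sh (fun a b => act (Q a) (fun Y => F (Y :: b)) X) w

theorem act_map (f : U →+ W) (A : Module.End K V) (φ : V × V → U) (X : V × V) :
    f (act A φ X) = act A (fun Y => f (φ Y)) X := by simp [act]

/-- Insertion changes only the arguments, so it commutes with every additive map of the values:
evaluation at a vector or a pair, scaling, the action of a fixed endomorphism. -/
theorem der_map (Q : List (V × V) → Module.End K V) (f : U →+ W) (F : List (V × V) → U)
    (w : List (V × V)) : der Q (fun u => f (F u)) w = f (der Q F w) := by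
  induction w generalizing F with
  | nil => simp [der]
  | cons X w ih => simp only [der, ih, map_add, ksplit_map, act_map]

theorem der_add (Q : List (V × V) → Module.End K V) (F F' : List (V × V) → U)
    (w : List (V × V)) : der Q (fun u => F u + F' u) w = der Q F w + der Q F' w := by
  induction w generalizing F F' with
  | nil => simp [der]
  | cons X w ih =>
    simp only [der, ih]
    rw [add_add_add_comm, ← ksplit_add]
    congr 2
    ext a b
    simp only [act]; abel

theorem der_smul (Q : List (V × V) → Module.End K V) {S : Type*} [Monoid S]
    [DistribMulAction S U] (c : S) (F : List (V × V) → U) (w : List (V × V)) :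
    der Q (fun u => c • F u) w = c • der Q F w :=
  der_map Q (DistribSMul.toAddMonoidHom U c) F w

theorem der_zero (Q : List (V × V) → Module.End K V) (w : List (V × V)) :
    der Q (fun _ => (0 : U)) w = 0 := by
  simpa using der_map Q (0 : U →+ U) (fun _ => 0) w

theorem der_mem_multi {Q : List (V × V) → Module.End K V} {F : List (V × V) → U}
    (hQ : Q ∈ multi K V (Module.End K V)) (hF : F ∈ multi K V U) : der Q F ∈ multi K V U := by
  have hsh : ∀ F ∈ multi K V U, ∀ X,
      sh (fun a b => act (Q a) (fun Y => F (Y :: b)) X) ∈ multi K V U := by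
    intro F hF X
    refine sh_mem_multi (fun b => ?_) (fun a => ?_)
    · exact multi_map ((LinearMap.proj X).comp ((Submodule.subtype _).comp
        ((actL K V U).flip ⟨_, multi_head hF b⟩))) hQ
    · exact add_mem (multi_cons hF _) (multi_cons hF _)
  intro u v
  induction u generalizing F with
  | nil =>
    simp only [List.nil_append, der]
    refine add_mem ?_ ?_
    · refine ⟨fun x x' y => ?_, fun c x y => ?_, fun x y => ?_⟩
      · simp only [← der_add]; congr 1; funext u; exact (multi_head hF u).1 x x' y
      · simp only [← der_smul]; congr 1; funext u; exact (multi_head hF u).2.1 c x y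
      · simp only
        rw [← neg_one_smul K, ← der_smul]; congr 1; funext u; rw [neg_one_smul]
        exact (multi_head hF u).2.2 x y
    · have e : (fun X => sh (fun a b => act (Q a) (fun Y => F (Y :: b)) X) v)
          = (sh (fun a b => actL K V U (Q a) ⟨_, multi_head hF b⟩) v).1 := by
        ext X
        have := ksplit_map (fun _ => 1) (((LinearMap.proj X : (V × V → U) →ₗ[K] U).comp
          (altBil K V U).subtype).toAddMonoidHom)
          (fun a b => actL K V U (Q a) ⟨_, multi_head hF b⟩) v
        exact this.symm
      rw [e]
      exact Subtype.property _
  | cons Y u ih =>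
    simp only [List.cons_append, der]
    exact add_mem (ih (multi_cons hF Y)) (hsh F hF Y u v)

theorem der_add_left (P Q : List (V × V) → Module.End K V) {F : List (V × V) → U}
    (hF : F ∈ multi K V U) (w : List (V × V)) :
    der (P + Q) F w = der P F w + der Q F w := by
  induction w generalizing F with
  | nil => simp [der]
  | cons X w ih =>
    simp only [der, ih (multi_cons hF X)]
    rw [add_add_add_comm, ← ksplit_add]
    congr 1
    refine ksplit_congr _ fun a b _ => ?_
    have := congrArg (fun φ => (φ ⟨_, multi_head hF b⟩).1 X) ((actL K V U).map_add (P a) (Q a))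
    exact this

theorem der_smul_left (c : K) (P : List (V × V) → Module.End K V) {F : List (V × V) → U}
    (hF : F ∈ multi K V U) (w : List (V × V)) :
    der (c • P) F w = c • der P F w := by
  induction w generalizing F with
  | nil => simp [der]
  | cons X w ih =>
    simp only [der, ih (multi_cons hF X)]
    rw [smul_add, ← ksplit_smul]
    congr 1
    refine ksplit_congr _ fun a b _ => ?_
    have := congrArg (fun φ => (φ ⟨_, multi_head hF b⟩).1 X) ((actL K V U).map_smul c (P a))
    exact this

end der

/-! ### Graded commutators of insertions -/

section prelie
universe u v
variable {K : Type u} {V U : Type v} [Field K] [AddCommGroup V] [Module K V] [AddCommGroup U]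
  [Module K U]

theorem IsDeg.smul_eq {G U : Type*} [AddCommGroup U] {n : ℤ} {F : List G → U} (hF : IsDeg n F)
    (w : List G) (k : ℤ) : sg (w.length * k) • F w = sg (n * k) • F w := by
  by_cases h : (w.length : ℤ) = n
  · rw [h]
  · rw [hF w h, smul_zero, smul_zero]

theorem act_zero (φ : V × V → U) (hφ : φ ∈ altBil K V U) (X : V × V) :
    act (0 : Module.End K V) φ X = 0 := by
  simp [act, altBil_zero_left hφ, altBil_zero_right hφ]

theorem sh_assoc {G U : Type*} [AddCommGroup U] (φ : List G → List G → List G → U) (w : List G) :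
    sh (fun a e => sh (fun b c => φ a b c) e) w
      = sh (fun f c => sh (fun a b => φ a b c) f) w := ksplit_assoc _ _ _

theorem sh_comm {G U : Type*} [AddCommGroup U] (φ : List G → List G → U) (w : List G) :
    sh φ w = sh (fun a b => sg (a.length * b.length) • φ b a) w := by
  simpa using ksplit_comm (fun _ => 1) φ w

theorem IsDeg.act_sg_smul {P : List (V × V) → Module.End K V} {p : ℤ} (hP : IsDeg p P)
    {φ : V × V → U} (hφ : φ ∈ altBil K V U) (w : List (V × V)) (k : ℤ) (X : V × V) :
    sg (p * k) • act (P w) φ X = sg (w.length * k) • act (P w) φ X := by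
  by_cases h : (w.length : ℤ) = p
  · rw [h]
  · rw [hP w h, act_zero _ hφ, smul_zero, smul_zero]

/-- Twisting the argument of `der Q` by the parity of the length. -/
theorem der_sg_length {Q : List (V × V) → Module.End K V} {q : ℤ} (hQ : IsDeg q Q)
    {F : List (V × V) → U} (hF : F ∈ multi K V U) (w : List (V × V)) :
    der Q (fun b => sg b.length • F b) w = sg (q + w.length) • der Q F w := by
  induction w generalizing F with
  | nil => simp [der]
  | cons X w ih =>
    simp only [der, smul_add]
    congr 1
    · have h := ih (F := fun u => sg 1 • F (X :: u))
        ((multi K V U).smul_of_tower_mem (sg 1 : ℤ) (multi_cons hF X))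
      rw [der_smul, smul_smul, ← sg_add] at h
      rw [List.length_cons, Nat.cast_add, Nat.cast_one, ← add_assoc, ← h]
      refine congrArg (fun G => der Q G w) (funext fun u => ?_)
      rw [List.length_cons, Nat.cast_add, Nat.cast_one, sg_add, mul_smul]
    · rw [← ksplit_smul]
      refine ksplit_congr _ fun a b hab => ?_
      by_cases ha : (a.length : ℤ) = q
      · have : act (Q a) (fun Y => sg (Y :: b).length • F (Y :: b)) X
            = sg (b.length + 1) • act (Q a) (fun Y => F (Y :: b)) X := by
          simp [act, smul_add]
        rw [this]
        congr 1
        have hl := hab.length_eq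
        rw [List.length_append] at hl
        rw [List.length_cons, ← hl, ← ha]
        push_cast
        rw [show (a.length : ℤ) + (a.length + b.length + 1) = a.length + a.length
          + (b.length + 1) by ring, sg_add (a.length + a.length), sg_add a.length, sg_mul_self,
          one_mul]
      · rw [hQ a ha, act_zero _ (multi_head hF b), smul_zero]
        simp only [act, LinearMap.zero_apply]
        rw [altBil_zero_left (multi_head hF b), altBil_zero_right (multi_head hF b)]
        simp

theorem act_sh (A : Module.End K V) (φ : V × V → List (V × V) → List (V × V) → U)
    (X : V × V) (w : List (V × V)) :
    act A (fun Y => sh (φ Y) w) X = sh (fun a b => act A (fun Y => φ Y a b) X) w := by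
  simp only [act]
  rw [← ksplit_add]

/-- `der P` is a derivation of the shuffle product. -/
theorem der_sh {P : List (V × V) → Module.End K V} {p : ℤ} (hP : IsDeg p P)
    {φ : List (V × V) → List (V × V) → U}
    (h1 : ∀ b, (fun a => φ a b) ∈ multi K V U) (h2 : ∀ a, φ a ∈ multi K V U)
    (w : List (V × V)) :
    der P (sh φ) w = sh (fun a b => der P (fun c => φ c b) a) w
      + sh (fun a b => sg (p * a.length) • der P (φ a) b) w := by
  induction w generalizing φ with
  | nil => simp [der, ksplit]
  | cons X w ih =>
    -- Expansion at the head `X`. In `e1` the insertion happens below `X`, in `e2` at `X` itself,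
    -- and in both `X` may lie in either block. If it is inserted at `X` in the second block, the
    -- arguments of `P` have to pass the first block; in `e3` the sign of cocommutativity cancels
    -- the sign `(-1)^(p |a|)`.
    have e1 : der P (fun u => sh φ (X :: u)) w
        = der P (sh fun a b => φ a (X :: b)) w
          + der P (sh fun a b => sg b.length • φ (X :: a) b) w := by
      rw [← der_add]
      exact congrArg (fun G => der P G w) (funext fun u => sh_cons _ _ _)
    have e2 : sh (fun a b => act (P a) (fun Y => sh φ (Y :: b)) X) w
        = sh (fun f c => sh (fun a b => act (P a) (fun Y => φ b (Y :: c)) X) f) w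
          + sh (fun f c => sg c.length •
              sh (fun a b => act (P a) (fun Y => φ (Y :: b) c) X) f) w := by
      have : ∀ c e, act (P c) (fun Y => sh φ (Y :: e)) X
          = sh (fun a b => act (P c) (fun Y => φ a (Y :: b)) X
            + sg b.length • act (P c) (fun Y => φ (Y :: a) b) X) e := by
        intro c e
        simp only [sh_cons, ← ksplit_add]
        rw [act_sh]
        refine ksplit_congr _ fun a b _ => ?_
        simp only [act, smul_add]
        abel
      simp only [this]
      rw [sh_assoc (fun c a b => act (P c) (fun Y => φ a (Y :: b)) X
            + sg b.length • act (P c) (fun Y => φ (Y :: a) b) X), ← ksplit_add]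
      refine ksplit_congr _ fun f c _ => ?_
      exact (ksplit_add _ _ _ f).trans (congrArg _ (ksplit_smul _ _ _ f))
    have e3 : sh (fun a b => sg (p * a.length) • sh (fun c e => act (P c) (fun Y => φ a (Y :: e)) X) b) w
        = sh (fun f c => sh (fun a b => act (P a) (fun Y => φ b (Y :: c)) X) f) w := by
      simp only [← ksplit_smul]
      rw [sh_assoc (fun a c e => sg (p * a.length) • act (P c) (fun Y => φ a (Y :: e)) X)]
      refine ksplit_congr _ fun f c _ => ?_
      rw [sh_comm]
      refine ksplit_congr _ fun a b _ => ?_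
      rw [hP.act_sg_smul (multi_head (h2 b) c), sg_smul_smul]
    have e4 := ih (φ := fun a b => sg b.length • φ (X :: a) b)
      (fun b => multi_sg_smul (fun _ => sg b.length) (fun _ _ _ _ => rfl) (multi_cons (h1 b) X))
      (fun a => multi_sg_smul (fun b => sg b.length) (fun _ _ _ _ => by simp) (h2 (X :: a)))
    have e5 : sh (fun a b => sg (p * a.length) • der P (fun b => sg b.length • φ (X :: a) b) b) w
        = sh (fun a b => sg b.length • sg (p * (X :: a).length) • der P (φ (X :: a)) b) w := by
      refine ksplit_congr _ fun a b _ => ?_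
      rw [der_sg_length hP (h2 (X :: a)), smul_smul, smul_smul, ← sg_add, ← sg_add,
        List.length_cons]
      congr 2
      push_cast
      ring
    rw [e5] at e4
    simp only [der_smul] at e4
    rw [der, e1, ih (fun b => h1 (X :: b)) (fun a => multi_cons (h2 a) X), e4, e2, sh_cons, sh_cons,
      ← e3]
    simp only [der, smul_add, ksplit_add]
    abel

/-- `R ρ Q F` adds to `der Q F` the shuffle product of `F` with `Q` acting through `ρ`. -/
def rder (ρ : Module.End K V →ₗ[K] Module.End K U) (Q : List (V × V) → Module.End K V)
    (F : List (V × V) → U) (w : List (V × V)) : U :=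
  der Q F w + sh (fun a b => ρ (Q a) (F b)) w

/-- Right multiplication of endomorphisms. -/
def mulRightL (K V : Type*) [Field K] [AddCommGroup V] [Module K V] :
    Module.End K V →ₗ[K] Module.End K (Module.End K V) :=
  (LinearMap.mul K (Module.End K V)).flip

/-- The circle product of cochains with values in `End V`. -/
def circ (P Q : List (V × V) → Module.End K V) : List (V × V) → Module.End K V :=
  rder (mulRightL K V) Q P

theorem circ_apply (P Q : List (V × V) → Module.End K V) (w : List (V × V)) :
    circ P Q w = der Q P w + sh (fun a b => P b * Q a) w := rfl

theorem circ_mem_multi {P Q : List (V × V) → Module.End K V}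
    (hP : P ∈ multi K V (Module.End K V)) (hQ : Q ∈ multi K V (Module.End K V)) :
    circ P Q ∈ multi K V (Module.End K V) :=
  add_mem (der_mem_multi hQ hP) (sh_mem_multi
    (fun b => multi_map ((LinearMap.mul K (Module.End K V)) (P b)) hQ)
    (fun a => multi_map (mulRightL K V (Q a)) hP))

theorem IsDeg.der {P : List (V × V) → U} {Q : List (V × V) → Module.End K V} {p q : ℤ}
    (hP : IsDeg p P) (hPm : P ∈ multi K V U) (hQ : IsDeg q Q) : IsDeg (p + q) (der Q P) := by
  intro w hw
  induction w generalizing P p with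
  | nil => rfl
  | cons X w ih =>
    rw [_root_.der, ih (p := p - 1) (fun u hu => hP _ ?_) (multi_cons hPm X), zero_add]
    · refine ksplit_eq_zero _ fun a b hab => ?_
      by_cases ha : (a.length : ℤ) = q
      · have hb : ∀ Y, P (Y :: b) = 0 := fun Y => hP _ fun h => hw (by
          have hl := hab.length_eq
          simp only [List.length_append, List.length_cons] at hl h ⊢
          push_cast at h ⊢
          omega)
        simp [act, hb]
      · rw [hQ a ha, act_zero _ (multi_head hPm b)]
    · simp only [List.length_cons] at hw ⊢
      push_cast at hw ⊢
      omega
    · simp only [List.length_cons] at hw ⊢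
      push_cast at hw ⊢
      omega

theorem IsDeg.circ {P Q : List (V × V) → Module.End K V} {p q : ℤ}
    (hP : IsDeg p P) (hPm : P ∈ multi K V (Module.End K V)) (hQ : IsDeg q Q) :
    IsDeg (p + q) (circ P Q) := by
  intro w hw
  rw [circ_apply, hP.der hPm hQ w hw, zero_add]
  refine ksplit_eq_zero _ fun a b hab => ?_
  by_cases ha : (a.length : ℤ) = q
  · rw [hP b, zero_mul]
    have hl := hab.length_eq
    simp only [List.length_append] at hl
    omega
  · rw [hQ a ha, mul_zero]

/-- The graded commutator of two operators `rder ρ P`, `rder ρ Q`, provided that it is known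
for `der P`, `der Q`. -/
theorem rder_comm_of_der_comm {ρ : Module.End K V →ₗ[K] Module.End K U}
    (hρ : ∀ A B u, ρ A (ρ B u) - ρ B (ρ A u) = ρ (B * A - A * B) u)
    {P Q : List (V × V) → Module.End K V} {p q : ℤ} (hP : IsDeg p P) (hQ : IsDeg q Q)
    (hPm : P ∈ multi K V (Module.End K V)) (hQm : Q ∈ multi K V (Module.End K V))
    {F : List (V × V) → U} (hF : F ∈ multi K V U) (w : List (V × V))
    (hder : der P (der Q F) w - sg (p * q) • der Q (der P F) w
      = der (circ Q P - (sg (p * q) : ℤ) • circ P Q) F w) :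
    rder ρ P (rder ρ Q F) w - sg (p * q) • rder ρ Q (rder ρ P F) w
      = rder ρ (circ Q P - (sg (p * q) : ℤ) • circ P Q) F w := by
  -- The mixed terms, where one of `P`, `Q` is inserted into `F` and the other acts through `ρ`,
  -- cancel in the graded commutator. There remain the double insertions (`hder`), the insertions of
  -- one of `P`, `Q` into the other, and the double actions through `ρ`, which `hρ` turns into the
  -- product terms of `circ`.
  have hexp : ∀ {P Q : List (V × V) → Module.End K V} {p q : ℤ}, IsDeg p P → IsDeg q Q →
      P ∈ multi K V (Module.End K V) → Q ∈ multi K V (Module.End K V) →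
      rder ρ P (rder ρ Q F) w = der P (der Q F) w + sh (fun a b => ρ (der P Q a) (F b)) w
        + sg (p * q) • sh (fun a b => ρ (Q a) (der P F b)) w
        + sh (fun a b => ρ (P a) (der Q F b)) w
        + sh (fun f b => sh (fun c a => ρ (P c) (ρ (Q a) (F b))) f) w := by
    intro P Q p q hP hQ hPm hQm
    have e1 := der_sh hP (φ := fun a b => ρ (Q a) (F b))
      (fun b => multi_map (ρ.flip (F b)) hQm) (fun a => multi_map (ρ (Q a)) hF) w
    have e2 : sh (fun a b => der P (fun c => ρ (Q c) (F b)) a) w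
        = sh (fun a b => ρ (der P Q a) (F b)) w :=
      ksplit_congr _ fun a b _ => der_map P (ρ.flip (F b)).toAddMonoidHom Q a
    have e3 : sh (fun a b => sg (p * a.length) • der P (fun c => ρ (Q a) (F c)) b) w
        = sg (p * q) • sh (fun a b => ρ (Q a) (der P F b)) w := by
      rw [← ksplit_smul]
      refine ksplit_congr _ fun a b _ => ?_
      have h : der P (fun c => ρ (Q a) (F c)) b = ρ (Q a) (der P F b) :=
        der_map P (ρ (Q a)).toAddMonoidHom F b
      rw [h]
      by_cases ha : (a.length : ℤ) = q
      · rw [ha]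
      · simp [hQ a ha]
    have e4 : sh (fun a b => ρ (P a) (rder ρ Q F b)) w = sh (fun a b => ρ (P a) (der Q F b)) w
        + sh (fun f b => sh (fun c a => ρ (P c) (ρ (Q a) (F b))) f) w := by
      rw [← sh_assoc (fun c a b => ρ (P c) (ρ (Q a) (F b))), ← ksplit_add]
      refine ksplit_congr _ fun a b _ => ?_
      rw [rder, map_add]
      exact congrArg _ (ksplit_map _ (ρ (P a)).toAddMonoidHom _ _)
    rw [rder, e4, show rder ρ Q F = fun w => der Q F w + sh (fun a b => ρ (Q a) (F b)) w from rfl,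
      der_add]
    rw [e1, e2, e3]
    abel
  have hcomm : sg (p * q) • sh (fun f b => sh (fun c a => ρ (Q c) (ρ (P a) (F b))) f) w
      = sh (fun f b => sh (fun a c => ρ (Q c) (ρ (P a) (F b))) f) w := by
    rw [← ksplit_smul]
    refine ksplit_congr _ fun f b _ => ?_
    rw [sh_comm, ← ksplit_smul]
    refine ksplit_congr _ fun a c _ => ?_
    by_cases ha : (a.length : ℤ) = p
    · by_cases hc : (c.length : ℤ) = q
      · rw [ha, hc, sg_smul_smul]
      · simp [hQ c hc]
    · simp [hP a ha]
  have hcirc : sg (p * q) • sh (fun f b => ρ (sh (fun a c => P c * Q a) f) (F b)) w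
      = sh (fun f b => ρ (sh (fun c a => P c * Q a) f) (F b)) w := by
    rw [← ksplit_smul]
    refine ksplit_congr _ fun f b _ => ?_
    rw [sh_comm (fun c a => P c * Q a), Units.smul_def, ← LinearMap.smul_apply, ← map_zsmul,
      ← Units.smul_def, ← ksplit_smul]
    refine congrArg (fun A => ρ A (F b)) (ksplit_congr _ fun a c _ => ?_)
    by_cases ha : (a.length : ℤ) = q
    · by_cases hc : (c.length : ℤ) = p
      · rw [ha, hc, mul_comm]
      · simp [hP c hc]
    · simp [hQ a ha]
  have hr : sh (fun f b => ρ ((circ Q P - (sg (p * q) : ℤ) • circ P Q) f) (F b)) w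
      = sh (fun a b => ρ (der P Q a) (F b)) w
        - sg (p * q) • sh (fun a b => ρ (der Q P a) (F b)) w
        + sh (fun f b => ρ (sh (fun c a => Q a * P c) f) (F b)) w
        - sg (p * q) • sh (fun f b => ρ (sh (fun a c => P c * Q a) f) (F b)) w := by
    rw [← ksplit_smul, ← ksplit_smul, ← ksplit_sub, ← ksplit_add, ← ksplit_sub]
    refine ksplit_congr _ fun f b _ => ?_
    simp only [Pi.sub_apply, Pi.smul_apply, circ_apply, map_sub, map_add, map_zsmul,
      LinearMap.sub_apply, LinearMap.add_apply, LinearMap.smul_apply, smul_add, Units.smul_def]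
    abel
  have hlie : sh (fun f b => sh (fun c a => ρ (P c) (ρ (Q a) (F b))) f) w
      - sh (fun f b => sh (fun a c => ρ (Q c) (ρ (P a) (F b))) f) w
      = sh (fun f b => ρ (sh (fun c a => Q a * P c) f) (F b)) w
        - sh (fun f b => ρ (sh (fun c a => P c * Q a) f) (F b)) w := by
    rw [← ksplit_sub, ← ksplit_sub]
    refine ksplit_congr _ fun f b _ => ?_
    rw [← ksplit_sub, ← LinearMap.sub_apply, ← map_sub, ← ksplit_sub]
    have := ksplit_map (fun _ => 1) (ρ.flip (F b)).toAddMonoidHom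
      (fun c a => Q a * P c - P c * Q a) f
    refine Eq.trans (ksplit_congr _ fun a b _ => ?_) this.symm
    exact hρ _ _ _
  rw [hexp hP hQ hPm hQm, hexp hQ hP hQm hPm, rder, ← hder, hr, hcirc, mul_comm q p]
  simp only [smul_add, sg_smul_smul]
  rw [hcomm]
  rw [← sub_eq_zero] at hlie ⊢
  refine Eq.trans ?_ hlie
  abel

end prelie

/-! ### The pre-Lie product and the graded Lie algebra of cochains -/

section prelie
universe u v
variable {K : Type u} {V : Type v} [Field K] [AddCommGroup V] [Module K V]

/-- A multilinear function of nonempty lists as a function of lists with values in the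
antisymmetric bilinear functions of the head. -/
def hat {U : Type v} [AddCommGroup U] [Module K U] {F : List (V × V) → U} (hF : F ∈ multi K V U)
    (w : List (V × V)) : altBil K V U := ⟨fun X => F (X :: w), multi_head hF w⟩

theorem hat_mem {U : Type v} [AddCommGroup U] [Module K U] {F : List (V × V) → U}
    (hF : F ∈ multi K V U) : hat hF ∈ multi K V (altBil K V U) := by
  refine fun u v => ⟨fun x x' y => ?_, fun c x y => ?_, fun x y => ?_⟩ <;> ext X
  · exact (hF (X :: u) v).1 x x' y
  · exact (hF (X :: u) v).2.1 c x y
  · exact (hF (X :: u) v).2.2 x y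

/-- Insertion at the head is the action `actL` on the values of `hat hF`, insertion elsewhere is
`der` on the shorter list. -/
theorem der_cons_eq_rder {U : Type v} [AddCommGroup U] [Module K U] {F : List (V × V) → U}
    (hF : F ∈ multi K V U) (Q : List (V × V) → Module.End K V) (X : V × V) (w : List (V × V)) :
    der Q F (X :: w) = (rder (actL K V U) Q (hat hF) w).1 X := by
  let ev : altBil K V U →+ U :=
    ((LinearMap.proj X : (V × V → U) →ₗ[K] U).comp (altBil K V U).subtype).toAddMonoidHom
  have h1 := der_map Q ev (hat hF) w
  have h2 := ksplit_map (fun _ => 1) ev (fun a b => actL K V U (Q a) (hat hF b)) w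
  exact congrArg₂ (· + ·) h1 h2.symm

/-- Induction on the list with the value space left free. On `X :: w` both operators become `rder`
on `w` with values in `altBil K V U`, and `rder_comm_of_der_comm` then asks only for the identity on
`w` in that value space. The universe of `U` is that of `V`, so that `altBil K V U` is again
admissible. -/
theorem der_comm (w : List (V × V)) : ∀ {U : Type v} [AddCommGroup U] [Module K U]
    {P Q : List (V × V) → Module.End K V} {p q : ℤ} (_ : IsDeg p P) (_ : IsDeg q Q)
    (_ : P ∈ multi K V (Module.End K V)) (_ : Q ∈ multi K V (Module.End K V))
    {F : List (V × V) → U} (_ : F ∈ multi K V U),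
    der P (der Q F) w - sg (p * q) • der Q (der P F) w
      = der (circ Q P - (sg (p * q) : ℤ) • circ P Q) F w := by
  induction w with
  | nil => intros; simp [der]
  | cons X w ih =>
    intro U _ _ P Q p q hP hQ hPm hQm F hF
    have h : ∀ {Q : List (V × V) → Module.End K V} (hQm : Q ∈ multi K V (Module.End K V)),
        hat (der_mem_multi hQm hF) = rder (actL K V U) Q (hat hF) := by
      intro Q hQm
      funext u
      ext Y
      exact der_cons_eq_rder hF Q Y u
    rw [der_cons_eq_rder (der_mem_multi hQm hF), der_cons_eq_rder (der_mem_multi hPm hF),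
      der_cons_eq_rder hF, h, h, ← rder_comm_of_der_comm actL_bracket hP hQ hPm hQm (hat_mem hF) w
        (ih hP hQ hPm hQm (hat_mem hF)), Units.smul_def, Units.smul_def]
    · rfl
    · exact hPm
    · exact hQm

/-- The circle product is a graded right pre-Lie product. -/
theorem circ_prelie {F P Q : List (V × V) → Module.End K V} {p q : ℤ} (hP : IsDeg p P)
    (hQ : IsDeg q Q) (hF : F ∈ multi K V (Module.End K V)) (hPm : P ∈ multi K V (Module.End K V))
    (hQm : Q ∈ multi K V (Module.End K V)) :
    circ (circ F Q) P - (sg (p * q) : ℤ) • circ (circ F P) Q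
      = circ F (circ Q P - (sg (p * q) : ℤ) • circ P Q) := by
  funext w
  -- The operator `circ · Q` is `rder` for right multiplication, so the same commutator lemma
  -- applies with values in `End V`.
  refine rder_comm_of_der_comm (fun A B u => ?_) hP hQ hPm hQm hF w (der_comm w hP hQ hPm hQm hF)
  simp [mulRightL, mul_assoc]

/-- The space of all (not necessarily homogeneous) Lie triple system cochains of `V`, as functions
of lists of pairs; the head of a list is the last pair. -/
def cochains (K : Type u) (V : Type v) [Field K] [AddCommGroup V] [Module K V] :
    Submodule K (List (V × V) → Module.End K V) where
  carrier := {F | F ∈ multi K V (Module.End K V) ∧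
    ∀ x y z w, F ((x, y) :: w) z + F ((y, z) :: w) x + F ((z, x) :: w) y = 0}
  zero_mem' := ⟨zero_mem _, by simp⟩
  add_mem' := by
    rintro f g ⟨f1, f2⟩ ⟨g1, g2⟩
    refine ⟨add_mem f1 g1, fun x y z w => ?_⟩
    have := congrArg₂ (· + ·) (f2 x y z w) (g2 x y z w)
    simp only [add_zero] at this
    simp only [Pi.add_apply, LinearMap.add_apply]
    rw [← this]
    abel
  smul_mem' := by
    rintro c f ⟨f1, f2⟩
    refine ⟨Submodule.smul_mem _ c f1, fun x y z w => ?_⟩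
    simp only [Pi.smul_apply, LinearMap.smul_apply, ← smul_add, f2, smul_zero]

/-- For the cyclic identity, sort the terms by the place of the last pair and the final vector. If
`Q` is inserted elsewhere, or acts on exactly one of `x`, `y`, `z`, the cyclic identity of `P`
applies (in the second case three times); if `Q` takes all three, that of `Q` applies. -/
theorem circ_mem {P Q : List (V × V) → Module.End K V} (hP : P ∈ cochains K V)
    (hQ : Q ∈ cochains K V) : circ P Q ∈ cochains K V := by
  refine ⟨circ_mem_multi hP.1 hQ.1, fun x y z w => ?_⟩
  have key : ∀ x y z, circ P Q ((x, y) :: w) z = der Q (fun u => P ((x, y) :: u) z) w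
      + sh (fun a b => P ((Q a x, y) :: b) z + P ((x, Q a y) :: b) z + P ((x, y) :: b) (Q a z)) w
      + sh (fun a b => sg b.length • P b (Q ((x, y) :: a) z)) w := by
    intro x y z
    let ev : Module.End K V →+ V := LinearMap.toAddMonoidHom (LinearMap.applyₗ z)
    have h1 := der_map Q ev (fun u => P ((x, y) :: u)) w
    have h2 := fun φ => ksplit_map (fun _ => 1) ev φ w
    rw [circ_apply, sh_cons, der, LinearMap.add_apply, LinearMap.add_apply, LinearMap.add_apply]
    have h3 : sh (fun a b => P ((Q a x, y) :: b) z + P ((x, Q a y) :: b) z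
          + P ((x, y) :: b) (Q a z)) w
        = sh (fun a b => P ((Q a x, y) :: b) z + P ((x, Q a y) :: b) z) w
          + sh (fun a b => P ((x, y) :: b) (Q a z)) w := ksplit_add _ _ _ _
    rw [h3]
    have h2a := h2 (fun a b => act (Q a) (fun Y => P (Y :: b)) (x, y))
    have h2b := h2 (fun a b => P ((x, y) :: b) * Q a)
    have h2c := h2 (fun a b => sg b.length • (P b * Q ((x, y) :: a)))
    refine (congrArg₂ (· + ·) (congrArg₂ (· + ·) h1.symm h2a) (congrArg₂ (· + ·) h2b h2c)).trans ?_
    rw [add_assoc, add_assoc, add_assoc]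
    have h4 : ∀ a b, ev (sg b.length • (P b * Q ((x, y) :: a)))
        = sg b.length • P b (Q ((x, y) :: a) z) := fun a b => rfl
    simp only [h4]
    rfl
  rw [key, key, key]
  have e1 : der Q (fun u => P ((x, y) :: u) z) w + der Q (fun u => P ((y, z) :: u) x) w
      + der Q (fun u => P ((z, x) :: u) y) w = 0 := by
    rw [← der_add, ← der_add]
    simp only [hP.2, der_zero]
  have e2 : sh (fun a b => sg b.length • P b (Q ((x, y) :: a) z)) w
      + sh (fun a b => sg b.length • P b (Q ((y, z) :: a) x)) w
      + sh (fun a b => sg b.length • P b (Q ((z, x) :: a) y)) w = 0 := by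
    rw [← ksplit_add, ← ksplit_add]
    refine ksplit_eq_zero _ fun a b _ => ?_
    rw [← smul_add, ← smul_add, ← map_add, ← map_add, hQ.2, map_zero, smul_zero]
  have e3 : sh (fun a b => P ((Q a x, y) :: b) z + P ((x, Q a y) :: b) z
        + P ((x, y) :: b) (Q a z)) w
      + sh (fun a b => P ((Q a y, z) :: b) x + P ((y, Q a z) :: b) x + P ((y, z) :: b) (Q a x)) w
      + sh (fun a b => P ((Q a z, x) :: b) y + P ((z, Q a x) :: b) y + P ((z, x) :: b) (Q a y)) w
      = 0 := by
    rw [← ksplit_add, ← ksplit_add]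
    refine ksplit_eq_zero _ fun a b _ => ?_
    have h1 := hP.2 (Q a x) y z b
    have h2 := hP.2 x (Q a y) z b
    have h3 := hP.2 x y (Q a z) b
    have h := congrArg₂ (· + ·) (congrArg₂ (· + ·) h1 h2) h3
    simp only [add_zero] at h
    refine Eq.trans ?_ h
    abel
  have h := congrArg₂ (· + ·) (congrArg₂ (· + ·) e1 e2) e3
  simp only [add_zero] at h
  refine Eq.trans ?_ h
  abel

/-- The type of cochains. -/
def Coch (K : Type u) (V : Type v) [Field K] [AddCommGroup V] [Module K V] : Type v := cochains K V

instance : AddCommGroup (Coch K V) := inferInstanceAs (AddCommGroup (cochains K V))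

instance : Module K (Coch K V) := inferInstanceAs (Module K (cochains K V))

namespace Coch

theorem ext {F G : Coch K V} (h : ∀ w, F.1 w = G.1 w) : F = G := Subtype.ext (funext h)

@[simp] theorem zero_val (w : List (V × V)) : (0 : Coch K V).1 w = 0 := rfl

@[simp] theorem add_val (F G : Coch K V) (w : List (V × V)) : (F + G).1 w = F.1 w + G.1 w := rfl

@[simp] theorem sub_val (F G : Coch K V) (w : List (V × V)) : (F - G).1 w = F.1 w - G.1 w := rfl

@[simp] theorem smul_val (c : K) (F : Coch K V) (w : List (V × V)) : (c • F).1 w = c • F.1 w := rfl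

@[simp] theorem zsmul_val (c : ℤ) (F : Coch K V) (w : List (V × V)) : (c • F).1 w = c • F.1 w := rfl

end Coch

variable (K V) in
/-- The circle product as a bilinear map. -/
def circL : Coch K V →ₗ[K] Coch K V →ₗ[K] Coch K V :=
  LinearMap.mk₂ K (fun P Q => ⟨circ P.1 Q.1, circ_mem P.2 Q.2⟩)
    (fun P P' Q => by
      refine Subtype.ext (funext fun w => ?_)
      change circ (P.1 + P'.1) Q.1 w = circ P.1 Q.1 w + circ P'.1 Q.1 w
      simp only [circ_apply, Pi.add_apply, add_mul, ksplit_add]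
      rw [show P.1 + P'.1 = fun w => P.1 w + P'.1 w from rfl, der_add]
      abel)
    (fun c P Q => by
      refine Subtype.ext (funext fun w => ?_)
      change circ (c • P.1) Q.1 w = c • circ P.1 Q.1 w
      simp only [circ_apply, Pi.smul_apply, smul_mul_assoc, ksplit_smul, smul_add]
      rw [show c • P.1 = fun w => c • P.1 w from rfl, der_smul])
    (fun P Q Q' => by
      refine Subtype.ext (funext fun w => ?_)
      change circ P.1 (Q.1 + Q'.1) w = circ P.1 Q.1 w + circ P.1 Q'.1 w
      simp only [circ_apply, Pi.add_apply, mul_add, ksplit_add, der_add_left _ _ P.2.1]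
      abel)
    (fun c P Q => by
      refine Subtype.ext (funext fun w => ?_)
      change circ P.1 (c • Q.1) w = c • circ P.1 Q.1 w
      simp only [circ_apply, Pi.smul_apply, mul_smul_comm, ksplit_smul, smul_add,
        der_smul_left _ _ P.2.1])

theorem circL_apply (P Q : Coch K V) : (circL K V P Q).1 = circ P.1 Q.1 := rfl

variable (K V) in
/-- The parity automorphism. -/
def parity : Coch K V →ₗ[K] Coch K V where
  toFun F := ⟨fun w => sg w.length • F.1 w,
    multi_sg_smul (fun w => sg w.length) (fun _ _ _ _ => by simp) F.2.1, fun x y z w => by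
      have := F.2.2 x y z w
      simp only [List.length_cons, Units.smul_def, LinearMap.smul_apply, ← smul_add, this,
        smul_zero]⟩
  map_add' F G := Subtype.ext (funext fun w => smul_add _ _ _)
  map_smul' c F := Subtype.ext (funext fun w => smul_comm (sg w.length) c (F.1 w))

theorem parity_of_isDeg {F : Coch K V} {n : ℤ} (hF : IsDeg n F.1) :
    parity K V F = (sg n : ℤ) • F := by
  refine Subtype.ext (funext fun w => ?_)
  have := hF.smul_eq w 1
  simp only [mul_one] at this
  exact this

variable (K V) in
/-- The graded Lie bracket. -/
def bra : Coch K V →ₗ[K] Coch K V →ₗ[K] Coch K V :=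
  circL K V - (2⁻¹ : K) • ((circL K V).flip + (circL K V).flip.comp (parity K V)
    + ((circL K V).comp (parity K V)).flip - ((circL K V).comp (parity K V)).flip.comp (parity K V))

/-- With parities `ε = (-1)^p` and `ε' = (-1)^q` one has `(-1)^(pq) = (1 + ε + ε' - ε ε') / 2`. This
lets `bra` be bilinear on all cochains, homogeneous or not. -/
theorem bra_eq [CharZero K] {P Q : Coch K V} {p q : ℤ} (hP : IsDeg p P.1) (hQ : IsDeg q Q.1) :
    bra K V P Q = circL K V P Q - (sg (p * q) : ℤ) • circL K V Q P := by
  simp only [bra, LinearMap.sub_apply, LinearMap.smul_apply, LinearMap.add_apply,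
    LinearMap.flip_apply, LinearMap.comp_apply, parity_of_isDeg hP, parity_of_isDeg hQ, map_zsmul,
    LinearMap.smul_apply]
  congr 1
  have h2 : (2 : K) ≠ 0 := two_ne_zero
  rw [inv_smul_eq_iff₀ h2]
  rcases Int.even_or_odd p with hp | hp <;> rcases Int.even_or_odd q with hq | hq
  all_goals
    simp only [sg, Even.neg_one_zpow, Odd.neg_one_zpow, hp, hq, Even.mul_left, Even.mul_right,
      Odd.mul, Even.neg_one_zpow, Odd.neg_one_zpow]
    simp [two_smul, sub_eq_add_neg]

theorem isDeg_bra [CharZero K] {P Q : Coch K V} {p q : ℤ} (hP : IsDeg p P.1)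
    (hQ : IsDeg q Q.1) : IsDeg (p + q) (bra K V P Q).1 := by
  intro w hw
  rw [bra_eq hP hQ]
  have h1 : (circL K V P Q).1 w = 0 := hP.circ P.2.1 hQ w hw
  have h2 : (circL K V Q P).1 w = 0 := hQ.circ Q.2.1 hP w (by rwa [add_comm])
  simp [h1, h2]

theorem bra_comm [CharZero K] {P Q : Coch K V} {p q : ℤ} (hP : IsDeg p P.1)
    (hQ : IsDeg q Q.1) : bra K V P Q = -((sg (p * q) : ℤ) • bra K V Q P) := by
  rw [bra_eq hP hQ, bra_eq hQ hP, mul_comm q p, smul_sub, smul_smul, ← Units.val_mul, sg_mul_self]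
  simp

/-- The graded Jacobi identity, saying that `[·, a]` is a right derivation. -/
theorem bra_jacobi [CharZero K] {x y a : Coch K V} {i j k : ℤ} (hx : IsDeg i x.1)
    (hy : IsDeg j y.1) (ha : IsDeg k a.1) :
    bra K V (bra K V x y) a
      = bra K V x (bra K V y a) + (sg (k * j) : ℤ) • bra K V (bra K V x a) y := by
  have pl : ∀ {F P Q : Coch K V} {p q : ℤ}, IsDeg p P.1 → IsDeg q Q.1 →
      circL K V (circL K V F Q) P = circL K V F (circL K V Q P)
        - (sg (p * q) : ℤ) • circL K V F (circL K V P Q)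
        + (sg (p * q) : ℤ) • circL K V (circL K V F P) Q := by
    intro F P Q p q hP hQ
    rw [← map_zsmul, ← map_sub, ← sub_eq_iff_eq_add]
    exact Subtype.ext (circ_prelie hP hQ F.2.1 P.2.1 Q.2.1)
  rw [bra_eq (isDeg_bra hx hy) ha, bra_eq hx (isDeg_bra hy ha), bra_eq (isDeg_bra hx ha) hy,
    bra_eq hx hy, bra_eq hy ha, bra_eq hx ha]
  simp only [map_sub, map_zsmul, LinearMap.sub_apply, LinearMap.smul_apply]
  -- One pre-Lie identity for each choice of the leftmost factor; the rest cancels for all values of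
  -- the three signs.
  rw [pl (F := x) ha hy, pl (F := y) hx ha, pl (F := a) hx hy]
  simp only [add_mul, mul_add, sg_add, mul_comm k, Units.val_mul]
  have h1 := Int.units_eq_one_or (sg (i * j))
  have h2 := Int.units_eq_one_or (sg (i * k))
  have h3 := Int.units_eq_one_or (sg (j * k))
  rcases h1 with h1 | h1 <;> rcases h2 with h2 | h2 <;> rcases h3 with h3 | h3 <;>
    rw [h1, h2, h3] <;> simp <;> abel

end prelie

/-! ### The weight filtration and iterated brackets with `C^*(M, L)` -/

section filtration
variable {K L M U : Type*} [Field K] [AddCommGroup L] [Module K L] [AddCommGroup M] [Module K M]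

open Classical in
/-- Indicator of the subspace `L` of `L × M`. -/
noncomputable def lcount (v : L × M) : ℤ := if v.2 = 0 then 1 else 0

theorem lcount_nonneg (v : L × M) : 0 ≤ lcount v := by
  unfold lcount; split_ifs <;> simp

theorem lcount_of_snd {v : L × M} (h : v.2 = 0) : lcount v = 1 := if_pos h

/-- Number of entries of a list of pairs that lie in `L`. -/
noncomputable abbrev pcount (w : List ((L × M) × (L × M))) : ℤ :=
  degSum (fun X => lcount X.1 + lcount X.2) w

theorem pcount_nonneg (w : List ((L × M) × (L × M))) : 0 ≤ pcount w := by
  induction w with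
  | nil => simp
  | cons X w ih =>
    rw [pcount, degSum_cons]
    have := lcount_nonneg X.1
    have := lcount_nonneg X.2
    linarith

variable (K L M) in
/-- Cochains that vanish if more than `e` entries are in `L`, and have values in `L` if at least
`e` entries are in `L`. -/
noncomputable def fil (e : ℤ) : Submodule K (Coch K (L × M)) where
  carrier := {F | ∀ w z, (e < pcount w + lcount z → F.1 w z = 0) ∧
    (e ≤ pcount w + lcount z → (F.1 w z).2 = 0)}
  zero_mem' := fun w z => by simp
  add_mem' := fun {F G} hF hG w z => by
    refine ⟨fun h => ?_, fun h => ?_⟩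
    · simp [(hF w z).1 h, (hG w z).1 h]
    · simp [(hF w z).2 h, (hG w z).2 h]
  smul_mem' := fun c F hF w z => by
    refine ⟨fun h => ?_, fun h => ?_⟩
    · simp [(hF w z).1 h]
    · simp [(hF w z).2 h]

theorem eq_zero_of_mem_fil {e : ℤ} (he : e < 0) {F : Coch K (L × M)} (hF : F ∈ fil K L M e) :
    F = 0 := by
  refine Coch.ext fun w => LinearMap.ext fun z => (hF w z).1 ?_
  have := pcount_nonneg w
  have := lcount_nonneg z
  linarith

/-- The weight bound at a nonzero value: entries in `L`, minus one if the value is in `L`, are at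
most `e - 1`. -/
theorem fil_lcount {e : ℤ} {Q : Coch K (L × M)} (hQ : Q ∈ fil K L M e)
    {c : List ((L × M) × (L × M))} {z : L × M} (h : Q.1 c z ≠ 0) :
    pcount c + lcount z + 1 ≤ e + lcount (Q.1 c z) := by
  have h1 : pcount c + lcount z ≤ e := by
    by_contra hlt
    exact h ((hQ c z).1 (not_le.1 hlt))
  rcases h1.lt_or_eq with h2 | h2
  · have := lcount_nonneg (Q.1 c z)
    linarith
  · rw [lcount_of_snd ((hQ c z).2 h2.ge)]
    linarith

/-- A nonzero inserted value of `Q` replaces its arguments and lowers the number of entries in `L`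
by at most `e' - 1`, so `F` still sees more than `e` of them. A zero value is killed by bilinearity.
-/
theorem der_eq_zero_of_mem_fil {U : Type*} [AddCommGroup U] [Module K U]
    {F : List ((L × M) × (L × M)) → U} (hF : F ∈ multi K (L × M) U) {e e' : ℤ}
    (hFe : ∀ w, e < pcount w → F w = 0) {Q : Coch K (L × M)} (hQ : Q ∈ fil K L M e')
    (w : List ((L × M) × (L × M))) (hw : e + e' ≤ pcount w) : der Q.1 F w = 0 := by
  induction w generalizing F e with
  | nil => rfl
  | cons X w ih =>
    simp only [pcount, degSum_cons] at hw
    rw [der, ih (e := e - (lcount X.1 + lcount X.2)) (multi_cons hF X)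
      (fun u hu => hFe _ (by rw [pcount, degSum_cons]; linarith)) (by linarith), zero_add]
    refine ksplit_eq_zero _ fun a b hab => ?_
    have hp := degSum_perm (fun X : (L × M) × (L × M) => lcount X.1 + lcount X.2) hab
    rw [degSum_append] at hp
    have h1 : F ((Q.1 a X.1, X.2) :: b) = 0 := by
      by_cases h : Q.1 a X.1 = 0
      · rw [h]; exact altBil_zero_left (multi_head hF b) _
      · refine hFe _ ?_
        have := fil_lcount hQ h
        simp only [pcount, degSum_cons] at *
        linarith
    have h2 : F ((X.1, Q.1 a X.2) :: b) = 0 := by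
      by_cases h : Q.1 a X.2 = 0
      · rw [h]; exact altBil_zero_right (multi_head hF b) _
      · refine hFe _ ?_
        have := fil_lcount hQ h
        simp only [pcount, degSum_cons] at *
        linarith
    rw [act, h1, h2, add_zero]

/-- The map `f` treats both conditions of `fil` together: the identity for vanishing, and the
projection to `M`, with bound `e - 1`, for values in `L`. -/
theorem map_circ_eq_zero {U : Type*} [AddCommGroup U] [Module K U] (f : (L × M) →ₗ[K] U)
    {P Q : Coch K (L × M)} {e e' : ℤ}
    (hP : ∀ w z, e < pcount w + lcount z → f (P.1 w z) = 0) (hQ : Q ∈ fil K L M e')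
    (w : List ((L × M) × (L × M))) (z : L × M) (h : e + e' ≤ pcount w + lcount z) :
    f ((circL K (L × M) P Q).1 w z) = 0 := by
  have h1 : f (der Q.1 P.1 w z) = 0 := by
    have := der_map Q.1 (f.comp (LinearMap.applyₗ z)).toAddMonoidHom P.1 w
    refine this.symm.trans (der_eq_zero_of_mem_fil (e := e - lcount z)
      (multi_map (f.comp (LinearMap.applyₗ z)) P.2.1) (fun u hu => hP _ _ (by linarith)) hQ w
      (by linarith))
  have h2 : f (sh (fun a b => P.1 b * Q.1 a) w z) = 0 := by
    have := ksplit_map (fun _ => 1) (f.comp (LinearMap.applyₗ z)).toAddMonoidHom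
      (fun a b => P.1 b * Q.1 a) w
    refine this.trans (ksplit_eq_zero _ fun a b hab => ?_)
    have hp := degSum_perm (fun X : (L × M) × (L × M) => lcount X.1 + lcount X.2) hab
    rw [degSum_append] at hp
    change f (P.1 b (Q.1 a z)) = 0
    by_cases h0 : Q.1 a z = 0
    · rw [h0, map_zero, map_zero]
    · refine hP _ _ ?_
      have := fil_lcount hQ h0
      simp only [pcount] at *
      linarith
  rw [circL_apply, circ_apply, LinearMap.add_apply, map_add, h1, h2, add_zero]

theorem circ_mem_fil {P Q : Coch K (L × M)} {e e' : ℤ} (hP : P ∈ fil K L M e)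
    (hQ : Q ∈ fil K L M e') : circL K (L × M) P Q ∈ fil K L M (e + e' - 1) := by
  intro w z
  refine ⟨fun h => ?_, fun h => ?_⟩
  · exact map_circ_eq_zero LinearMap.id (fun w z => (hP w z).1) hQ w z (by linarith)
  · exact map_circ_eq_zero (LinearMap.snd K L M) (e := e - 1)
      (fun w z h => (hP w z).2 (by linarith)) hQ w z
      (by linarith)

variable [CharZero K]

theorem bra_mem_fil {P Q : Coch K (L × M)} {e e' p q : ℤ} (hP : P ∈ fil K L M e)
    (hQ : Q ∈ fil K L M e') (hPd : IsDeg p P.1) (hQd : IsDeg q Q.1) :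
    bra K (L × M) P Q ∈ fil K L M (e + e' - 1) := by
  rw [bra_eq hPd hQd]
  have h := circ_mem_fil hQ hP
  rw [add_comm e' e] at h
  refine sub_mem (circ_mem_fil hP hQ) ?_
  rw [← Int.cast_smul_eq_zsmul K]
  exact Submodule.smul_mem _ _ h

/-- The iterated bracket `[[Δ, a₁], …, aₙ]`, where the head of the list is `aₙ`. -/
def iter {K V : Type*} [Field K] [AddCommGroup V] [Module K V] (Δ : Coch K V) :
    List (ℤ × Coch K V) → Coch K V
  | [] => Δ
  | a :: w => bra K V (iter Δ w) a.2

/-- A list of homogeneous elements (paired with their degrees) of `C^*(M, L)`. -/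
def Good (w : List (ℤ × Coch K (L × M))) : Prop :=
  ∀ a ∈ w, IsDeg a.1 a.2.1 ∧ a.2 ∈ fil K L M 0

theorem good_cons {a : ℤ × Coch K (L × M)} {w : List (ℤ × Coch K (L × M))} :
    Good (a :: w) ↔ (IsDeg a.1 a.2.1 ∧ a.2 ∈ fil K L M 0) ∧ Good w := by
  simp [Good]

theorem Good.perm {u w : List (ℤ × Coch K (L × M))} (hw : Good w) (h : u.Perm w) : Good u :=
  fun a ha => hw a (h.mem_iff.1 ha)

theorem good_append {u w : List (ℤ × Coch K (L × M))} : Good (u ++ w) ↔ Good u ∧ Good w := by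
  simp only [Good, List.mem_append, or_imp, forall_and]
  tauto

variable {Δ Δ' : Coch K (L × M)} {w : List (ℤ × Coch K (L × M))}

theorem isDeg_iter {n : ℤ} (hΔ : IsDeg n Δ.1) (hw : Good w) :
    IsDeg (degSum Prod.fst w + n) (iter Δ w).1 := by
  induction w with
  | nil => simpa [iter] using hΔ
  | cons a w ih =>
    rw [good_cons] at hw
    have := isDeg_bra (ih hw.2) hw.1.1
    rw [degSum_cons, iter]
    convert this using 1
    ring

theorem iter_mem_fil {n e : ℤ} (hΔ : IsDeg n Δ.1) (he : Δ ∈ fil K L M e) (hw : Good w) :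
    iter Δ w ∈ fil K L M (e - w.length) := by
  induction w with
  | nil => simpa [iter] using he
  | cons a w ih =>
    rw [good_cons] at hw
    have := bra_mem_fil (ih hw.2) hw.1.2 (isDeg_iter hΔ hw.2) hw.1.1
    rw [List.length_cons, iter]
    convert this using 2
    push_cast
    ring

/-- The bracket lies in `fil (-1)`, which is zero. -/
theorem bra_eq_zero {a b : ℤ × Coch K (L × M)} (ha : IsDeg a.1 a.2.1 ∧ a.2 ∈ fil K L M 0)
    (hb : IsDeg b.1 b.2.1 ∧ b.2 ∈ fil K L M 0) : bra K (L × M) a.2 b.2 = 0 :=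
  eq_zero_of_mem_fil (by norm_num) (bra_mem_fil ha.2 hb.2 ha.1 hb.1)

/-- In the Jacobi identity the term with `[b, a]` vanishes. -/
theorem iter_swap {n : ℤ} (hΔ : IsDeg n Δ.1) {a b : ℤ × Coch K (L × M)}
    (hw : Good (a :: b :: w)) :
    iter Δ (a :: b :: w) = (sg (a.1 * b.1) : ℤ) • iter Δ (b :: a :: w) := by
  rw [good_cons, good_cons] at hw
  simp only [iter]
  rw [bra_jacobi (isDeg_iter hΔ hw.2.2) hw.2.1.1 hw.1.1, bra_eq_zero hw.2.1 hw.1, map_zero,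
    zero_add]

theorem iter_append (u v : List (ℤ × Coch K (L × M))) :
    iter Δ (u ++ v) = iter (iter Δ v) u := by
  induction u with
  | nil => rfl
  | cons a u ih => rw [List.cons_append, iter, ih, iter]

theorem iter_middle {n : ℤ} (hΔ : IsDeg n Δ.1) {a : ℤ × Coch K (L × M)}
    (u : List (ℤ × Coch K (L × M))) (hw : Good (a :: (u ++ w))) :
    iter Δ (u ++ a :: w) = (sg (a.1 * degSum Prod.fst u) : ℤ) • iter Δ (a :: (u ++ w)) := by
  induction u with
  | nil => simp [sg_zero]
  | cons b u ih =>
    rw [List.cons_append] at hw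
    have hs := iter_swap (a := b) (b := a) hΔ (hw.perm (List.Perm.swap a b _))
    rw [good_cons, good_cons] at hw
    rw [List.cons_append, List.cons_append, iter, ih (good_cons.2 ⟨hw.1, hw.2.2⟩), map_zsmul,
      LinearMap.smul_apply]
    have hs' : bra K (L × M) (iter Δ (a :: (u ++ w))) b.2
        = (sg (b.1 * a.1) : ℤ) • iter Δ (a :: b :: (u ++ w)) := hs
    rw [hs', smul_smul, degSum_cons, mul_add, sg_add, mul_comm b.1, Units.val_mul, mul_comm]

theorem iter_zero (u : List (ℤ × Coch K (L × M))) : iter (0 : Coch K (L × M)) u = 0 := by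
  induction u with
  | nil => rfl
  | cons a u ih => rw [iter, ih, map_zero, LinearMap.zero_apply]

/-- Carries `l` from the innermost to the outermost bracket, past all letters of `w`. -/
theorem iter_bra {n : ℤ} (hΔ : IsDeg n Δ.1) {l : Coch K (L × M)} {k : ℤ}
    (hl : IsDeg k l.1) (hl0 : l ∈ fil K L M 0) (hw : Good w) :
    iter (bra K (L × M) Δ l) w
      = (sg (k * degSum Prod.fst w) : ℤ) • bra K (L × M) (iter Δ w) l := by
  have h := iter_middle (w := []) (a := (k, l)) hΔ w
    (good_cons.2 ⟨⟨hl, hl0⟩, by simpa using hw⟩)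
  rw [iter_append] at h
  simpa [iter] using h

/-- Iterated brackets of a bracket. -/
theorem iter_bra_eq_ksplit {n : ℤ} (hΔ : IsDeg n Δ.1) (hΔ' : IsDeg 1 Δ'.1) (hw : Good w) :
    iter (bra K (L × M) Δ Δ') w
      = ksplit Prod.fst (fun u v => sg (degSum Prod.fst u) •
          bra K (L × M) (iter Δ u) (iter Δ' v)) w := by
  induction w with
  | nil => simp [iter, ksplit, sg_zero]
  | cons a w ih =>
    rw [good_cons] at hw
    have h := ksplit_map Prod.fst ((bra K (L × M)).flip a.2).toAddMonoidHom
      (fun u v => sg (degSum Prod.fst u) • bra K (L × M) (iter Δ u) (iter Δ' v)) w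
    rw [iter, ih hw.2, ksplit, ← ksplit_add]
    refine h.trans (ksplit_congr _ fun u v huv => ?_)
    have hg := good_append.1 (hw.2.perm huv)
    simp only [LinearMap.toAddMonoidHom_coe, LinearMap.flip_apply, Units.smul_def, map_zsmul]
    -- The letter `a` passes `iter Δ' v`, of degree one more than `v`. The surplus sign `(-1)^(deg
    -- a)` turns `(-1)^(deg u)` into the prefactor for `a :: u`.
    rw [bra_jacobi (isDeg_iter hΔ hg.1) (isDeg_iter hΔ' hg.2) hw.1.1, smul_add, smul_smul,
      smul_smul, ← Units.val_mul, ← Units.val_mul, degSum_cons, mul_add, sg_add, sg_add, mul_one,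
      mul_comm (sg (degSum _ u)), mul_assoc]
    rfl

/-- In the Leibniz expansion of the iterated bracket of `[Δ, Δ'] = 0`, the term of a splitting `u`,
`v` survives only if `|u| = i` or `|v| = i'`. Then that factor lies in `fil 0`, and `iter_bra` moves
it into the innermost bracket, as in a summand of the `L_∞` identity. -/
theorem jacobi_of_bra_eq_zero {i i' : ℕ} (hΔ : IsDeg 1 Δ.1) (hΔ' : IsDeg 1 Δ'.1)
    (he : Δ ∈ fil K L M i) (he' : Δ' ∈ fil K L M i') (h0 : bra K (L × M) Δ Δ' = 0)
    (hw : Good w) (hl : w.length + 1 = i + i') :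
    ksplit Prod.fst (fun u v => if u.length = i then
        iter (bra K (L × M) Δ' (iter Δ u)) v else 0) w
      + ksplit Prod.fst (fun u v => if u.length = i' then
        iter (bra K (L × M) Δ (iter Δ' u)) v else 0) w = 0 := by
  have h := iter_bra_eq_ksplit hΔ hΔ' hw
  rw [h0, iter_zero] at h
  rw [ksplit_comm _ (fun u v => if u.length = i' then
        iter (bra K (L × M) Δ (iter Δ' u)) v else 0), ← ksplit_add]
  refine Eq.trans ?_ h.symm
  refine ksplit_congr _ fun u v huv => ?_
  have hg := good_append.1 (hw.perm huv)
  have hlen := huv.length_eq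
  rw [List.length_append] at hlen
  have hu := iter_mem_fil hΔ he hg.1
  have hv := iter_mem_fil hΔ' he' hg.2
  have hud := isDeg_iter hΔ hg.1
  have hvd := isDeg_iter hΔ' hg.2
  by_cases h1 : u.length = i
  · rw [if_pos h1, if_neg (by omega), smul_zero, add_zero]
    rw [h1, sub_self] at hu
    rw [iter_bra hΔ' hud hu hg.2, bra_comm hud hvd, smul_neg, Units.smul_def, smul_smul,
      ← Units.val_mul, ← neg_smul]
    congr 1
    rw [mul_add, mul_one, sg_add _ (degSum _ u + 1), sg_add _ 1, sg_one]
    rw [mul_comm (degSum _ u + 1)]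
    rcases Int.units_eq_one_or (sg (degSum Prod.fst u)) with hs | hs <;> rw [hs] <;> simp
  · rw [if_neg h1, zero_add]
    by_cases h2 : v.length = i'
    · rw [if_pos h2]
      rw [h2, sub_self] at hv
      rw [iter_bra hΔ hvd hv hg.1, Units.smul_def, Units.smul_def, smul_smul, ← Units.val_mul]
      congr 2
      rw [add_mul, one_mul, sg_add, ← mul_assoc, mul_comm (degSum _ u), sg_mul_self, one_mul]
    · rw [if_neg h2, smul_zero]
      -- The lengths add up to `i + i' - 1`, so either `|v| > i'` or `|u| > i`, and that factor has
      -- negative filtration.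
      rcases lt_or_gt_of_ne h1 with h3 | h3
      · rw [eq_zero_of_mem_fil (by omega) hv, map_zero, smul_zero]
      · rw [eq_zero_of_mem_fil (by omega) hu, map_zero, LinearMap.zero_apply, smul_zero]

end filtration

/-! ### Degree-one cochains and the structure equations of `π + θ` and `H` -/

section degreeOne
universe u v
variable {K : Type u} {V : Type v} [Field K] [AddCommGroup V] [Module K V]

/-- The cochain of degree one given by a function of one pair. -/
def single (f : V × V → Module.End K V) : List (V × V) → Module.End K V
  | [X] => f X
  | _ => 0

theorem single_mem {f : V × V → Module.End K V} (hf : f ∈ altBil K V (Module.End K V))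
    (hc : ∀ x y z, f (x, y) z + f (y, z) x + f (z, x) y = 0) : single f ∈ cochains K V := by
  refine ⟨fun u v => ?_, fun x y z w => ?_⟩
  · match u, v with
    | [], [] => exact hf
    | [], _ :: _ => exact zero_mem _
    | [_], _ => exact zero_mem _
    | _ :: _ :: _, _ => exact zero_mem _
  · match w with
    | [] => exact hc x y z
    | _ :: _ => simp [single]

theorem isDeg_single (f : V × V → Module.End K V) : IsDeg 1 (single f) := by
  intro w hw
  match w with
  | [] => rfl
  | [_] => simp at hw
  | _ :: _ :: _ => rfl

/-- The bracket of two cochains of degree one vanishes if it does so on two pairs. -/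
theorem bra_single_eq_zero [CharZero K] {f g : V × V → Module.End K V} {F G : Coch K V}
    (hF : F.1 = single f) (hG : G.1 = single g)
    (h : ∀ X Y z, f (g X Y.1, Y.2) z + f (Y.1, g X Y.2) z + f Y (g X z) - f X (g Y z)
      + (g (f X Y.1, Y.2) z + g (Y.1, f X Y.2) z + g Y (f X z) - g X (f Y z)) = 0) :
    bra K V F G = 0 := by
  have hFd : IsDeg 1 F.1 := hF ▸ isDeg_single f
  have hGd : IsDeg 1 G.1 := hG ▸ isDeg_single g
  have hcirc : ∀ (f g : V × V → Module.End K V) X Y z,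
      circ (single f) (single g) [Y, X] z
        = f (g X Y.1, Y.2) z + f (Y.1, g X Y.2) z + f Y (g X z) - f X (g Y z) := by
    intro f g X Y z
    simp [circ_apply, der, ksplit, single, act, sg_one, sg_zero]
    abel
  refine Coch.ext fun w => ?_
  by_cases hw : (w.length : ℤ) = 1 + 1
  · match w with
    | [Y, X] =>
      rw [bra_eq hFd hGd]
      refine LinearMap.ext fun z => ?_
      have := h X Y z
      rw [← hcirc f g, ← hcirc g f] at this
      simpa [mul_one, sg_one, circL_apply, hF, hG] using this
    | [] => simp at hw
    | [_] => simp at hw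
    | _ :: _ :: _ :: _ => simp only [List.length_cons] at hw; push_cast at hw; omega
  · exact isDeg_bra hFd hGd w hw

end degreeOne

section structureMaps
variable {K L M : Type*} [Field K] [AddCommGroup L] [Module K L] [AddCommGroup M] [Module K M]
  (br : L →ₗ[K] L →ₗ[K] L →ₗ[K] L) (θ : L →ₗ[K] L →ₗ[K] Module.End K M)
  (H : L →ₗ[K] L →ₗ[K] L →ₗ[K] M)

/-- The semidirect product bracket as a function of one pair with values in endomorphisms. -/
def semiFun (X : (L × M) × (L × M)) : Module.End K (L × M) where
  toFun c := (br X.1.1 X.2.1 c.1, θ X.2.1 c.1 X.1.2 - θ X.1.1 c.1 X.2.2 + ltsD θ X.1.1 X.2.1 c.2)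
  map_add' c c' := by ext <;> simp [ltsD]; abel
  map_smul' k c := by ext <;> simp [ltsD, smul_sub, smul_add]

/-- The twist `H` as a function of one pair with values in endomorphisms. -/
def twistFun (X : (L × M) × (L × M)) : Module.End K (L × M) where
  toFun c := (0, H X.1.1 X.2.1 c.1)
  map_add' c c' := by ext <;> simp
  map_smul' k c := by ext <;> simp

theorem alternating_swap {W : Type*} [AddCommGroup W] [Module K W]
    {B : L →ₗ[K] L →ₗ[K] L →ₗ[K] W} (hB : ∀ x y, B x x y = 0) (x y z : L) :
    B x y z = -B y x z := by
  have h := hB (x + y) z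
  simp only [map_add, LinearMap.add_apply, hB, zero_add, add_zero] at h
  exact eq_neg_of_add_eq_zero_left ((add_comm _ _).trans h)

variable {br θ H}

theorem single_semiFun_mem (hbr : IsLieTripleSystem br) :
    single (semiFun br θ) ∈ cochains K (L × M) := by
  refine single_mem ⟨fun x x' y => ?_, fun c x y => ?_, fun x y => ?_⟩ fun x y z => ?_
  · refine LinearMap.ext fun z => ?_
    ext <;> simp [semiFun, ltsD]; abel
  · refine LinearMap.ext fun z => ?_
    ext <;> simp [semiFun, ltsD, smul_sub, smul_add]
  · refine LinearMap.ext fun z => ?_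
    ext
    · simpa [semiFun] using alternating_swap hbr.alternating _ _ _
    · simp [semiFun, ltsD]; abel
  · ext
    · simpa [semiFun] using hbr.cyclic _ _ _
    · simp [semiFun, ltsD]; abel

theorem single_twistFun_mem (hH : IsLTSThreeCocycle br θ H) :
    single (twistFun H) ∈ cochains K (L × M) := by
  refine single_mem ⟨fun x x' y => ?_, fun c x y => ?_, fun x y => ?_⟩ fun x y z => ?_
  · refine LinearMap.ext fun z => ?_
    ext <;> simp [twistFun]
  · refine LinearMap.ext fun z => ?_
    ext <;> simp [twistFun]
  · refine LinearMap.ext fun z => ?_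
    ext
    · simp [twistFun]
    · simpa [twistFun] using alternating_swap hH.alternating _ _ _
  · ext
    · simp [twistFun]
    · simpa [twistFun] using hH.cyclic _ _ _

/-- `π + θ` as a cochain of `L × M`. -/
def semiCoch (hbr : IsLieTripleSystem br) (θ : L →ₗ[K] L →ₗ[K] Module.End K M) :
    Coch K (L × M) := ⟨single (semiFun br θ), single_semiFun_mem hbr⟩

/-- `H` as a cochain of `L × M`. -/
def twistCoch (hH : IsLTSThreeCocycle br θ H) : Coch K (L × M) :=
  ⟨single (twistFun H), single_twistFun_mem hH⟩

theorem lcount_le_one (v : L × M) : lcount v ≤ 1 := by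
  unfold lcount; split_ifs <;> simp

/-- There are only three entries, and if all of them are in `L` the value is the triple bracket of
`L`. -/
theorem semiCoch_mem_fil (hbr : IsLieTripleSystem br) : semiCoch hbr θ ∈ fil K L M 3 := by
  intro w z
  match w with
  | [] => exact ⟨fun _ => rfl, fun _ => rfl⟩
  | _ :: _ :: _ => exact ⟨fun _ => rfl, fun _ => rfl⟩
  | [X] =>
    have h1 := lcount_le_one X.1
    have h2 := lcount_le_one X.2
    have h3 := lcount_le_one z
    simp only [pcount, degSum_cons, degSum_nil]
    refine ⟨fun h => by linarith, fun h => ?_⟩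
    have key : ∀ v : L × M, 1 ≤ lcount v → v.2 = 0 := by
      intro v hv
      by_contra h0
      rw [lcount, if_neg h0] at hv
      norm_num at hv
    have e1 := key X.1 (by linarith)
    have e2 := key X.2 (by linarith)
    have e3 := key z (by linarith)
    change (semiFun br θ X z).2 = 0
    simp [semiFun, e1, e2, e3]

/-- Both conditions are vacuous for three entries. Level 3 would require values in `L`, while `H`
takes values in `M`. -/
theorem twistCoch_mem_fil (hH : IsLTSThreeCocycle br θ H) : twistCoch hH ∈ fil K L M 4 := by
  intro w z
  match w with
  | [] => exact ⟨fun _ => rfl, fun _ => rfl⟩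
  | _ :: _ :: _ => exact ⟨fun _ => rfl, fun _ => rfl⟩
  | [X] =>
    have h1 := lcount_le_one X.1
    have h2 := lcount_le_one X.2
    have h3 := lcount_le_one z
    simp only [pcount, degSum_cons, degSum_nil]
    exact ⟨fun h => by linarith, fun h => by linarith⟩

theorem theta_comm (hθ : IsLTSRepresentation br θ) (x y z t : L) (m : M) :
    ltsD θ x y (θ z t m) = θ z t (ltsD θ x y m) + θ (br x y z) t m + θ z (br x y t) m := by
  have h := congrArg (fun A => A m) (hθ.rep_comm x y z t)
  simp only [LinearMap.add_apply, LinearMap.sub_apply, Module.End.mul_apply,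
    LinearMap.zero_apply] at h
  rw [← sub_eq_zero, ← neg_eq_zero]
  refine Eq.trans ?_ h
  abel

theorem theta_mul (hθ : IsLTSRepresentation br θ) (x y z t : L) (m : M) :
    θ x (br y z t) m = θ z t (θ x y m) - θ y t (θ x z m) + ltsD θ y z (θ x t m) := by
  have h := congrArg (fun A => A m) (hθ.rep_mul x y z t)
  simp only [LinearMap.add_apply, LinearMap.sub_apply, Module.End.mul_apply,
    LinearMap.zero_apply] at h
  rw [← sub_eq_zero, ← neg_eq_zero]
  refine Eq.trans ?_ h
  abel

variable [CharZero K]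

theorem bra_semiCoch_semiCoch (hbr : IsLieTripleSystem br) (hθ : IsLTSRepresentation br θ) :
    bra K (L × M) (semiCoch hbr θ) (semiCoch hbr θ) = 0 := by
  refine bra_single_eq_zero rfl rfl fun X Y z => ?_
  -- The two halves of the condition coincide, and each vanishes: the semidirect product satisfies
  -- the derivation axiom.
  have key : semiFun br θ (semiFun br θ X Y.1, Y.2) z + semiFun br θ (Y.1, semiFun br θ X Y.2) z
      + semiFun br θ Y (semiFun br θ X z) - semiFun br θ X (semiFun br θ Y z) = 0 := by
    obtain ⟨⟨x, u⟩, ⟨y, v⟩⟩ := X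
    obtain ⟨⟨a, m⟩, ⟨b, n⟩⟩ := Y
    obtain ⟨c, k⟩ := z
    ext
    · have := hbr.derivation x y a b c
      simp [semiFun, this]
    -- The `M`-component is a sum of terms linear in one entry of `M` each: `m`, `n`, `k` need
    -- `rep_comm` (twice for `k`, because of `D`), and `v`, `u` need `rep_mul`.
    · have e1 := theta_comm hθ x y b c m
      have e2 := theta_comm hθ x y a c n
      have e3 := theta_comm hθ x y a b k
      have e4 := theta_comm hθ x y b a k
      have e5 := theta_mul hθ x a b c v
      have e6 := theta_mul hθ y a b c u
      simp only [semiFun, LinearMap.coe_mk, AddHom.coe_mk, Prod.snd_add, Prod.snd_sub, map_add, map_sub, Prod.snd_zero]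
      simp only [ltsD, LinearMap.sub_apply, map_sub] at *
      rw [e1, e2, e3, e4, e5, e6]
      abel
  rw [key, add_zero]

theorem bra_semiCoch_twistCoch (hbr : IsLieTripleSystem br) (hH : IsLTSThreeCocycle br θ H) :
    bra K (L × M) (semiCoch hbr θ) (twistCoch hH) = 0 := by
  refine bra_single_eq_zero rfl rfl fun X Y z => ?_
  obtain ⟨⟨x, u⟩, ⟨y, v⟩⟩ := X
  obtain ⟨⟨a, m⟩, ⟨b, n⟩⟩ := Y
  obtain ⟨c, k⟩ := z
  have h := hH.cocycle x y a b c
  ext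
  · simp [semiFun, twistFun]
  · simp [semiFun, twistFun]
    simp only [ltsD, LinearMap.sub_apply, map_zero, LinearMap.zero_apply] at *
    rw [← sub_eq_zero, ← neg_eq_zero] at h
    refine Eq.trans ?_ h
    abel

/-- `H` reads only `L`-components and has values in `M`, so it cannot be composed with itself. -/
theorem bra_twistCoch_twistCoch (hH : IsLTSThreeCocycle br θ H) :
    bra K (L × M) (twistCoch hH) (twistCoch hH) = 0 := by
  refine bra_single_eq_zero rfl rfl fun X Y z => ?_
  ext <;> simp [twistFun]

end structureMaps

/-! ### Shuffle permutations and splittings of lists -/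

section shuffles

/-- The permutation of `Fin (n + 1)` that maps `j` to the last element and is given by `τ` on the
other elements. -/
def insPerm {n : ℕ} (j : Fin (n + 1)) (τ : Equiv.Perm (Fin n)) : Equiv.Perm (Fin (n + 1)) :=
  (finSuccEquiv' j).trans ((Equiv.optionCongr τ).trans (finSuccEquiv' (Fin.last n)).symm)

variable {n : ℕ}

@[simp] theorem insPerm_self (j : Fin (n + 1)) (τ : Equiv.Perm (Fin n)) :
    insPerm j τ j = Fin.last n := by
  simp [insPerm]

@[simp] theorem insPerm_succAbove (j : Fin (n + 1)) (τ : Equiv.Perm (Fin n)) (a : Fin n) :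
    insPerm j τ (j.succAbove a) = (τ a).castSucc := by
  simp [insPerm]

@[simp] theorem insPerm_last_castSucc (τ : Equiv.Perm (Fin n)) (a : Fin n) :
    insPerm (Fin.last n) τ a.castSucc = (τ a).castSucc := by
  rw [← Fin.succAbove_last_apply, insPerm_succAbove]

theorem insPerm_bijective :
    Function.Bijective (fun p : Fin (n + 1) × Equiv.Perm (Fin n) => insPerm p.1 p.2) := by
  rw [Fintype.bijective_iff_injective_and_card]
  constructor
  · rintro ⟨j, τ⟩ ⟨j', τ'⟩ h
    have h1 : ∀ a, insPerm j τ a = insPerm j' τ' a := fun a => congrArg (fun σ => σ a) h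
    have hj : j = j' := by
      refine (insPerm j' τ').injective ?_
      rw [← h1 j, insPerm_self, insPerm_self]
    subst hj
    have : τ = τ' := by
      ext a
      have := h1 (j.succAbove a)
      rw [insPerm_succAbove, insPerm_succAbove] at this
      exact congrArg Fin.val (Fin.castSucc_injective _ this)
    rw [this]
  · simp [Fintype.card_perm, Nat.factorial_succ]

theorem sum_perm_succ {U : Type*} [AddCommMonoid U] (f : Equiv.Perm (Fin (n + 1)) → U) :
    ∑ σ, f σ = ∑ j, ∑ τ, f (insPerm j τ) := by
  rw [← Fintype.sum_prod_type', ← insPerm_bijective.sum_comp f]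

theorem isShuffle_insPerm_last (i : ℕ) (τ : Equiv.Perm (Fin n)) :
    IsShuffle i (insPerm (Fin.last n) τ) ↔ IsShuffle i τ := by
  constructor
  · intro h a b hab hi
    have := h a.castSucc b.castSucc (by simpa using hab) (by simpa using hi)
    simpa using this
  · intro h a b hab hi
    induction b using Fin.lastCases with
    | last =>
      induction a using Fin.lastCases with
      | last => exact absurd hab (lt_irrefl _)
      | cast a => simp [Fin.castSucc_lt_last]
    | cast b =>
      induction a using Fin.lastCases with
      | last => exact absurd hab (Fin.castSucc_lt_last b).not_gt
      | cast a =>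
        simpa using h a b (by simpa using hab) (by simpa using hi)

theorem isShuffle_insPerm_mid (i : ℕ) (hi : i < n + 1) (τ : Equiv.Perm (Fin n)) :
    IsShuffle (i + 1) (insPerm ⟨i, hi⟩ τ) ↔ IsShuffle i τ := by
  have hv : ∀ a : Fin n, ((⟨i, hi⟩ : Fin (n + 1)).succAbove a : ℕ)
      = if (a : ℕ) < i then (a : ℕ) else a + 1 := by
    intro a
    simp only [Fin.succAbove, Fin.lt_def, Fin.val_castSucc]
    split_ifs <;> rfl
  constructor
  · intro h a b hab hb
    have := h ((⟨i, hi⟩ : Fin (n + 1)).succAbove a) ((⟨i, hi⟩ : Fin (n + 1)).succAbove b)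
      (by simpa using hab) (by
        rw [hv, hv]
        split_ifs <;> omega)
    simpa using this
  · intro h a b hab hb
    rcases Fin.eq_self_or_eq_succAbove ⟨i, hi⟩ b with rfl | ⟨b, rfl⟩
    · rcases Fin.eq_self_or_eq_succAbove ⟨i, hi⟩ a with rfl | ⟨a, rfl⟩
      · exact absurd hab (lt_irrefl _)
      · simp [Fin.castSucc_lt_last]
    · rcases Fin.eq_self_or_eq_succAbove ⟨i, hi⟩ a with rfl | ⟨a, rfl⟩
      · simp only [Fin.lt_def] at hab hb
        omega
      · rw [insPerm_succAbove, insPerm_succAbove, Fin.castSucc_lt_castSucc_iff]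
        refine h a b (by simpa using hab) ?_
        rw [hv, hv] at hb
        split_ifs at hb <;> omega

/-- The largest value stands at the end of one of the two increasing blocks. These two places match
the two terms in the recursion of `ksplit`. -/
theorem eq_of_isShuffle_insPerm {i : ℕ} {j : Fin (n + 1)} {τ : Equiv.Perm (Fin n)}
    (h : IsShuffle i (insPerm j τ)) : j = Fin.last n ∨ (j : ℕ) + 1 = i := by
  by_contra hne
  push Not at hne
  have hj : (j : ℕ) < n := lt_of_le_of_ne (Nat.le_of_lt_succ j.2) fun h => hne.1 (Fin.ext h)
  have := h j ⟨j + 1, by omega⟩ (by simp [Fin.lt_def]) (by simp only; omega)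
  rw [insPerm_self] at this
  exact absurd this (Fin.le_last _).not_gt

theorem sg_sum {ι : Type*} (s : Finset ι) (f : ι → ℤ) : ∏ a ∈ s, sg (f a) = sg (∑ a ∈ s, f a) := by
  classical
  induction s using Finset.induction_on with
  | empty => simp [sg_zero]
  | insert a s ha ih => rw [Finset.prod_insert ha, Finset.sum_insert ha, ih, sg_add]

/-- The new inversions are those of the last letter with the letters placed after it. -/
theorem koszulSign_insPerm (d : Fin (n + 1) → ℤ) (j : Fin (n + 1)) (τ : Equiv.Perm (Fin n)) :
    koszulSign d (insPerm j τ) = koszulSign (fun a => d a.castSucc) τ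
      * sg (d (Fin.last n) * ∑ b ∈ Finset.univ.filter (fun b : Fin n => (j : ℕ) ≤ b), d (τ b).castSucc) := by
  have hlt : ∀ b : Fin n, j < j.succAbove b ↔ (j : ℕ) ≤ b := by
    intro b
    rw [Fin.lt_succAbove_iff_le_castSucc]
    rfl
  simp only [koszulSign, Finset.prod_filter, Fintype.prod_prod_type]
  rw [Fin.prod_univ_succAbove _ j]
  simp only [Fin.prod_univ_succAbove _ j, lt_irrefl, if_false, one_mul, insPerm_self,
    insPerm_succAbove, (Fin.le_last _).not_gt, and_false, hlt, Fin.castSucc_lt_last, and_true,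
    Fin.succAbove_lt_succAbove_iff, Fin.castSucc_lt_castSucc_iff]
  rw [mul_comm, Finset.mul_sum, ← sg_sum, Finset.prod_filter]
  rfl

theorem ofFn_insPerm {G : Type*} (x : Fin (n + 1) → G) (j : Fin (n + 1)) (τ : Equiv.Perm (Fin n)) :
    List.ofFn (fun a => x (insPerm j τ a))
      = (List.ofFn fun a => x (τ a).castSucc).take j
        ++ x (Fin.last n) :: (List.ofFn fun a => x (τ a).castSucc).drop j := by
  refine List.ext_getElem (by simp; omega) fun k h1 h2 => ?_
  rw [List.getElem_ofFn]
  simp only [List.length_ofFn] at h1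
  have hmin : min (j : ℕ) n = j := by omega
  rcases Fin.eq_self_or_eq_succAbove j ⟨k, h1⟩ with h | ⟨a, h⟩
  · have hk : k = j := congrArg Fin.val h
    rw [h, insPerm_self]
    subst hk
    rw [List.getElem_append_right (by simp)]
    simp [hmin]
  · have hk : k = (j.succAbove a : ℕ) := congrArg Fin.val h
    rw [h, insPerm_succAbove]
    by_cases haj : (a : ℕ) < j
    · have : k = a := by rw [hk, Fin.succAbove_of_castSucc_lt _ _ haj]; rfl
      subst this
      rw [List.getElem_append_left (by simp [haj])]
      simp
    · have : k = a + 1 := by rw [hk, Fin.succAbove_of_le_castSucc _ _ (not_lt.1 haj)]; rfl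
      subst this
      rw [List.getElem_append_right (by simp; omega)]
      simp only [List.length_take, List.length_ofFn, hmin]
      have hs : (a : ℕ) + 1 - j = (a - j) + 1 := by omega
      simp only [hs, List.getElem_cons_succ, List.getElem_drop, List.getElem_ofFn]
      refine congrArg (fun b => x (τ b).castSucc) (Fin.ext ?_)
      simp only
      omega

theorem degSum_drop_ofFn {G : Type*} (d : G → ℤ) (x : Fin n → G) (j : ℕ) :
    degSum d ((List.ofFn x).drop j) = ∑ b ∈ Finset.univ.filter (fun b : Fin n => j ≤ b), d (x b) := by
  have h1 := List.sum_take_ofFn (fun b => d (x b)) j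
  have h2 : degSum d ((List.ofFn x).take j) + degSum d ((List.ofFn x).drop j)
      = ∑ b, d (x b) := by
    rw [← degSum_append, List.take_append_drop, degSum, List.map_ofFn, List.sum_ofFn]
    rfl
  have h3 : degSum d ((List.ofFn x).take j) = ∑ b ∈ Finset.univ.filter (fun b : Fin n => b < j), d (x b) := by
    rw [← h1, degSum, List.map_take, List.map_ofFn]
    rfl
  rw [h3, ← Finset.sum_filter_add_sum_filter_not Finset.univ (fun b : Fin n => (b : ℕ) < j)] at h2
  simpa using h2

theorem koszulSign_insPerm' {G : Type*} (d : G → ℤ) (x : Fin (n + 1) → G) (j : Fin (n + 1))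
    (τ : Equiv.Perm (Fin n)) :
    koszulSign (fun a => d (x a)) (insPerm j τ) = koszulSign (fun a => d (x a.castSucc)) τ
      * sg (d (x (Fin.last n)) * degSum d ((List.ofFn fun a => x (τ a).castSucc).drop j)) := by
  rw [koszulSign_insPerm, degSum_drop_ofFn]

theorem reverse_ofFn_succ {G : Type*} (x : Fin (n + 1) → G) :
    (List.ofFn x).reverse = x (Fin.last n) :: (List.ofFn fun a => x a.castSucc).reverse := by
  rw [List.ofFn_succ', List.concat_eq_append, List.reverse_append]
  rfl

/-- A sum over shuffles with Koszul signs is a sum over splittings of a list. -/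
theorem sum_isShuffle {G U : Type*} [AddCommGroup U] (d : G → ℤ) (φ : List G → List G → U)
    (i : ℕ) (hi : i ≤ n) (x : Fin n → G) :
    ∑ σ : Equiv.Perm (Fin n) with IsShuffle i σ, koszulSign (fun a => d (x a)) σ •
        φ ((List.ofFn fun a => x (σ a)).take i).reverse ((List.ofFn fun a => x (σ a)).drop i).reverse
      = ksplit d (fun a b => if a.length = i then φ a b else 0) (List.ofFn x).reverse := by
  induction n generalizing i φ with
  | zero =>
    obtain rfl : i = 0 := by omega
    have : (Finset.univ.filter fun σ : Equiv.Perm (Fin 0) => IsShuffle 0 σ) = {1} := by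
      ext σ
      simp [IsShuffle, Subsingleton.elim σ 1]
    rw [this]
    simp [koszulSign, ksplit]
  | succ n ih =>
    rw [Finset.sum_filter, sum_perm_succ, reverse_ofFn_succ, ksplit]
    set f : Fin (n + 1) → U := fun j => ∑ τ, if IsShuffle i (insPerm j τ) then
      koszulSign (fun a => d (x a)) (insPerm j τ) •
        φ ((List.ofFn fun a => x (insPerm j τ a)).take i).reverse
          ((List.ofFn fun a => x (insPerm j τ a)).drop i).reverse else 0 with hf
    have hf0 : ∀ j : Fin (n + 1), j ≠ Fin.last n → (j : ℕ) + 1 ≠ i → f j = 0 := by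
      intro j h1 h2
      refine Finset.sum_eq_zero fun τ _ => if_neg fun h => ?_
      rcases eq_of_isShuffle_insPerm h with h | h
      · exact h1 h
      · exact h2 h
    have hlast : i ≤ n → f (Fin.last n) = ksplit d (fun a b => if a.length = i then
        φ a (x (Fin.last n) :: b) else 0) (List.ofFn fun a => x a.castSucc).reverse := by
      intro hin
      rw [← ih (fun a b => φ a (x (Fin.last n) :: b)) i hin, Finset.sum_filter]
      refine Finset.sum_congr rfl fun τ _ => ?_
      refine if_congr (isShuffle_insPerm_last i τ) ?_ rfl
      have hl : (List.ofFn fun a => x (insPerm (Fin.last n) τ a))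
          = (List.ofFn fun a => x (τ a).castSucc) ++ [x (Fin.last n)] := by
        rw [ofFn_insPerm, List.take_of_length_le (by simp), List.drop_of_length_le (by simp)]
      rw [koszulSign_insPerm', List.drop_of_length_le (by simp), hl,
        List.take_append_of_le_length (by simpa using hin),
        List.drop_append_of_le_length (by simpa using hin), List.reverse_append]
      simp [sg_zero]
    have hmid : ∀ k (hk : k < n + 1), k + 1 = i → f ⟨k, hk⟩ = ksplit d (fun a b =>
        sg (d (x (Fin.last n)) * degSum d b) • if (x (Fin.last n) :: a).length = i then
        φ (x (Fin.last n) :: a) b else 0) (List.ofFn fun a => x a.castSucc).reverse := by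
      rintro k hk rfl
      have := ih (fun a b => sg (d (x (Fin.last n)) * degSum d b) • φ (x (Fin.last n) :: a) b) k
        (by omega) (fun a => x a.castSucc)
      have e : ∀ a b : List G, (sg (d (x (Fin.last n)) * degSum d b) •
          if (x (Fin.last n) :: a).length = k + 1 then φ (x (Fin.last n) :: a) b else 0)
          = if a.length = k then
            sg (d (x (Fin.last n)) * degSum d b) • φ (x (Fin.last n) :: a) b else 0 := by
        intro a b
        simp only [List.length_cons, Nat.add_right_cancel_iff, smul_ite, smul_zero]
      simp only [e]
      rw [← this, Finset.sum_filter]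
      refine Finset.sum_congr rfl fun τ _ => ?_
      refine if_congr (isShuffle_insPerm_mid k hk τ) ?_ rfl
      have hlen : ((List.ofFn fun a => x (τ a).castSucc).take k).length = k := by
        simp; omega
      have hx := ofFn_insPerm x ⟨k, hk⟩ τ
      simp only at hx
      have ht : (List.ofFn fun a => x (insPerm ⟨k, hk⟩ τ a)).take (k + 1)
          = (List.ofFn fun a => x (τ a).castSucc).take k ++ [x (Fin.last n)] := by
        rw [hx, List.take_append, hlen, Nat.add_sub_cancel_left,
          List.take_of_length_le (by omega)]
        simp
      have hd : (List.ofFn fun a => x (insPerm ⟨k, hk⟩ τ a)).drop (k + 1)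
          = (List.ofFn fun a => x (τ a).castSucc).drop k := by
        rw [hx, List.drop_append, hlen, Nat.add_sub_cancel_left,
          List.drop_of_length_le (by omega)]
        simp
      rw [koszulSign_insPerm', ht, hd, List.reverse_append, mul_smul,
        degSum_perm d (List.reverse_perm _)]
      rfl
    change ∑ j, f j = _
    -- One of the two places disappears when a block is empty: the end of the first block for `i =
    -- 0`, the end of the second for `i = n + 1`. In these cases the corresponding term of `ksplit`
    -- vanishes by length.
    rcases Nat.eq_zero_or_pos i with h0 | h0
    · subst h0
      rw [Fintype.sum_eq_single (Fin.last n) (fun j hj => hf0 j hj (by omega)),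
        hlast (Nat.zero_le _)]
      refine (add_eq_left.2 (ksplit_eq_zero _ fun a b _ => ?_)).symm
      simp
    · have hk : i - 1 < n + 1 := by omega
      have hk' : i - 1 + 1 = i := by omega
      by_cases hin : i ≤ n
      · have hne : Fin.last n ≠ ⟨i - 1, hk⟩ := by
          intro h
          have := congrArg Fin.val h
          simp only [Fin.val_last] at this
          omega
        rw [Fintype.sum_eq_add _ _ hne, hlast hin, hmid _ hk hk']
        rintro j ⟨h1, h2⟩
        refine hf0 j h1 fun h => h2 (Fin.ext ?_)
        simp only
        omega
      · have hn : i = n + 1 := by omega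
        rw [Fintype.sum_eq_single ⟨i - 1, hk⟩, hmid _ hk hk']
        · refine (add_eq_right.2 (ksplit_eq_zero _ fun a b hab => ?_)).symm
          rw [if_neg]
          have := hab.length_eq
          simp only [List.length_append, List.length_reverse, List.length_ofFn] at this
          omega
        · intro j hj
          have hj' : (j : ℕ) + 1 ≠ i := fun h => hj (Fin.ext (by simp only; omega))
          refine hf0 j (fun h => hj' ?_) hj'
          rw [h, Fin.val_last, hn]

end shuffles

/-! ### Comparison with the circle product of the statement -/

section comparison
universe u v
variable {K : Type u} {V : Type v} [Field K] [AddCommGroup V] [Module K V]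

/-- The recursion of `der` unrolled: `k` is the pair hit by `Q`, the later pairs are untouched, and
the earlier ones are split between `Q` and `F`. -/
theorem der_reverse_ofFn {U : Type*} [AddCommGroup U] (Q : List (V × V) → Module.End K V)
    (F : List (V × V) → U) {n : ℕ} (X : Fin n → V × V) :
    der Q F (List.ofFn X).reverse = ∑ k : Fin n,
      sh (fun a b => act (Q a) (fun Y => F (((List.ofFn X).drop (k + 1)).reverse ++ Y :: b)) (X k))
        ((List.ofFn X).take k).reverse := by
  induction n generalizing F with
  | zero => simp [der]
  | succ n ih =>
    have hl : List.ofFn X = (List.ofFn fun a => X a.castSucc) ++ [X (Fin.last n)] := by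
      rw [List.ofFn_succ', List.concat_eq_append]
    rw [reverse_ofFn_succ, der, ih, Fin.sum_univ_castSucc]
    congr 1
    · refine Finset.sum_congr rfl fun k _ => ?_
      rw [hl, Fin.val_castSucc, List.take_append_of_le_length (by simp),
        List.drop_append_of_le_length (by simp)]
      simp
    · rw [hl, Fin.val_last, List.take_append_of_le_length (by simp),
        List.take_of_length_le (by simp), List.drop_of_length_le (by simp)]
      simp

theorem koszulSign_one {n : ℕ} (σ : Equiv.Perm (Fin n)) :
    koszulSign (fun _ => 1) σ = Equiv.Perm.sign σ := by
  rw [Equiv.Perm.sign_eq_prod_prod_Ioi, koszulSign, Finset.prod_filter, Fintype.prod_prod_type]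
  refine Finset.prod_congr rfl fun a _ => ?_
  rw [← Finset.filter_lt_eq_Ioi, Finset.prod_filter]
  refine Finset.prod_congr rfl fun b _ => ?_
  by_cases hab : a < b
  · rcases lt_or_gt_of_ne (σ.injective.ne hab.ne) with h | h
    · simp [hab, h, h.not_gt]
    · simp [hab, h, h.not_gt]
  · simp [hab]

/-- Comparison of the two orders of the factors in a split where one factor has fixed length. -/
theorem sh_eq_sg_smul_ksplit {G U : Type*} [AddCommGroup U] {j q : ℕ}
    {φ : List G → List G → U} (hφ : ∀ b a, a.length ≠ q → φ b a = 0) {w : List G}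
    (hw : w.length = j + q) :
    sh (fun a b => φ b a) w
      = sg (j * q) • ksplit (fun _ => 1) (fun b a => if b.length = j then φ b a else 0) w := by
  rw [sh_comm, ← ksplit_smul]
  refine ksplit_congr _ fun b a hab => ?_
  have hl := hab.length_eq
  rw [List.length_append, hw] at hl
  by_cases ha : a.length = q
  · have hb : b.length = j := by omega
    rw [if_pos hb, ha, hb]
  · simp [hφ b a ha]

/-- `F` represents the function `f` of `n` pairs and a vector. -/
structure Represents {n : ℕ} (f : PairFun n V V) (F : Coch K V) : Prop where
  isDeg : IsDeg n F.1
  eq : ∀ X z, f X z = F.1 (List.ofFn X).reverse z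

theorem ofFn_ltsInsert {p q n : ℕ} (h : p + q = n) (X : Fin n → V × V) (j : Fin p)
    (σ : Equiv.Perm (Fin ((j : ℕ) + q))) (v : V × V) :
    List.ofFn (ltsInsert h X j σ v)
      = (List.ofFn fun a => X (Fin.castLE (by omega) (σ a))).take j
        ++ v :: (List.ofFn X).drop (j + q + 1) := by
  refine List.ext_getElem (by simp; omega) fun k h1 h2 => ?_
  rw [List.getElem_ofFn]
  simp only [List.length_ofFn] at h1
  have hmin : min (j : ℕ) (j + q) = j := by omega
  simp only [ltsInsert, Fin.lt_def, Fin.ext_iff]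
  rcases lt_trichotomy k j with hk | hk | hk
  · rw [dif_pos hk, List.getElem_append_left (by simp; omega)]
    simp
  · rw [dif_neg (by omega), if_pos hk, List.getElem_append_right (by simp; omega)]
    simp [hk]
  · obtain ⟨m, rfl⟩ : ∃ m, k = j + (m + 1) := ⟨k - j - 1, by omega⟩
    rw [dif_neg (by omega), if_neg (by omega), List.getElem_append_right (by simp)]
    simp only [List.length_take, List.length_ofFn, hmin, Nat.add_sub_cancel_left,
      List.getElem_cons_succ, List.getElem_drop, List.getElem_ofFn]
    refine congrArg X (Fin.ext ?_)
    simp only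
    omega

theorem ofFn_drop {G : Type*} {j q : ℕ} (x : Fin (j + q) → G) :
    (List.ofFn fun b : Fin q => x (Fin.natAdd j b)) = (List.ofFn x).drop j := by
  refine List.ext_getElem (by simp) fun k h1 h2 => ?_
  simp [List.getElem_ofFn, Fin.natAdd]

theorem ofFn_take {G : Type*} {j q : ℕ} (x : Fin (j + q) → G) :
    (List.ofFn fun b : Fin j => x (Fin.castAdd q b)) = (List.ofFn x).take j := by
  refine List.ext_getElem (by simp) fun k h1 h2 => ?_
  simp [List.getElem_ofFn, Fin.castAdd, Fin.castLE]

theorem neg_one_pow_smul_eq_sg {U : Type*} [AddCommGroup U] (n : ℕ) (u : U) :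
    (-1 : ℤ) ^ n • u = sg n • u := by
  rw [Units.smul_def, sg, zpow_natCast]
  simp

/-- The shuffles of the statement list the arguments of `P` before those of `Q`, whereas `circ`
lists those of `Q` first. Exchanging the blocks produces the prefactors `(-1)^((k-1) q)` and
`(-1)^(p q)`. -/
theorem ltsCirc_eq_circ {p q n : ℕ} (h : p + q = n) {P : PairFun p V V} {Q : PairFun q V V}
    {F G : Coch K V} (hP : Represents P F) (hQ : Represents Q G) (X : Fin n → V × V) (x : V) :
    ltsCirc h P Q X x = circ F.1 G.1 (List.ofFn X).reverse x := by
  subst h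
  rw [circ_apply, LinearMap.add_apply, ltsCirc]
  congr 1
  · rw [der_reverse_ofFn, LinearMap.sum_apply]
    -- The pair hit by `Q` has index `j + q`. Pairs of index below `q` contribute nothing, since
    -- fewer than `q` pairs precede them.
    refine Fintype.sum_of_injective (fun j : Fin p => (⟨j + q, by omega⟩ : Fin (p + q)))
      (fun a b hab => Fin.ext (by simpa using hab)) _ _ (fun k hk => ?_) (fun j => ?_)
    · have hkq : (k : ℕ) < q := by
        by_contra hkq
        exact hk ⟨⟨k - q, by omega⟩, Fin.ext (by simp only; omega)⟩
      have hz : sh (fun a b => act (G.1 a) (fun Y => F.1 (((List.ofFn X).drop (k + 1)).reverse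
          ++ Y :: b)) (X k)) ((List.ofFn X).take k).reverse = 0 := by
        refine ksplit_eq_zero _ fun a b hab => ?_
        have hl := hab.length_eq
        simp only [List.length_append, List.length_reverse, List.length_take,
          List.length_ofFn] at hl
        rw [hQ.isDeg a (by omega), act_zero _ (F.2.1 _ b)]
      rw [hz, LinearMap.zero_apply]
    · have hm : (List.ofFn X).take (j + q)
          = List.ofFn fun a : Fin (j + q) => X (Fin.castLE (by omega) a) := by
        refine List.ext_getElem (by simp) fun k h1 h2 => ?_
        simp [List.getElem_ofFn]
      simp only
      rw [hm]
      set Y := X ⟨j + q, by omega⟩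
      set t := ((List.ofFn X).drop (j + q + 1)).reverse
      have hs := sum_isShuffle (fun _ : V × V => 1) (fun b a =>
        act (G.1 a) (fun Y => F.1 (t ++ Y :: b)) Y x) (j : ℕ) (n := j + q) (by omega)
        (fun a => X (Fin.castLE (by omega) a))
      have h1 := ksplit_map (fun _ => 1) (LinearMap.toAddMonoidHom (LinearMap.applyₗ (R := K) x))
        (fun a b => act (G.1 a) (fun Y => F.1 (t ++ Y :: b)) Y)
        (List.ofFn fun a : Fin (j + q) => X (Fin.castLE (by omega) a)).reverse
      refine Eq.trans ?_ h1.symm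
      have h2 := sh_eq_sg_smul_ksplit (j := j) (q := q)
        (φ := fun b a => act (G.1 a) (fun Y => F.1 (t ++ Y :: b)) Y x) (fun b a ha => by
          rw [hQ.isDeg a (by exact_mod_cast ha), act_zero _ (F.2.1 t b), LinearMap.zero_apply])
        (w := (List.ofFn fun a : Fin (j + q) => X (Fin.castLE (by omega) a)).reverse) (by simp)
      refine Eq.trans ?_ h2.symm
      rw [← hs, neg_one_pow_smul_eq_sg, Nat.cast_mul]
      congr 1
      refine Finset.sum_congr rfl fun σ _ => ?_
      rw [koszulSign_one, Units.smul_def]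
      refine congrArg (fun u : V => (Equiv.Perm.sign σ : ℤ) • u) ?_
      simp only [hP.eq, hQ.eq, ofFn_ltsInsert, List.reverse_append, List.reverse_cons]
      rw [ofFn_drop fun b => X (Fin.castLE (by omega) (σ b))]
      simp only [act, LinearMap.add_apply, List.append_assoc, List.singleton_append]
      rfl
  · have hs := sum_isShuffle (fun _ : V × V => 1) (fun b a => F.1 b (G.1 a x)) p (n := p + q)
      (by omega) X
    have h1 := ksplit_map (fun _ => 1) (LinearMap.toAddMonoidHom (LinearMap.applyₗ (R := K) x))
      (fun a b => F.1 b * G.1 a) (List.ofFn X).reverse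
    refine Eq.trans ?_ h1.symm
    have h2 := sh_eq_sg_smul_ksplit (j := p) (q := q) (φ := fun b a => F.1 b (G.1 a x))
      (fun b a ha => by
        rw [hQ.isDeg a (by exact_mod_cast ha), LinearMap.zero_apply, map_zero])
      (w := (List.ofFn X).reverse) (by simp)
    refine Eq.trans ?_ h2.symm
    rw [← hs, neg_one_pow_smul_eq_sg, Nat.cast_mul]
    congr 1
    refine Finset.sum_congr rfl fun σ _ => ?_
    rw [koszulSign_one, Units.smul_def]
    refine congrArg (fun u : V => (Equiv.Perm.sign σ : ℤ) • u) ?_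
    simp only [hP.eq, hQ.eq, Fin.cast_eq_self]
    rw [ofFn_drop fun b => X (σ b), ofFn_take fun b => X (σ b)]

theorem Represents.bracket [CharZero K] {p q : ℕ} {P : PairFun p V V} {Q : PairFun q V V}
    {F G : Coch K V} (hP : Represents P F) (hQ : Represents Q G) :
    Represents (ltsBracket P Q) (bra K V F G) := by
  refine ⟨by exact_mod_cast isDeg_bra hP.isDeg hQ.isDeg, fun X z => ?_⟩
  rw [bra_eq hP.isDeg hQ.isDeg, Coch.sub_val, Coch.zsmul_val, LinearMap.sub_apply,
    LinearMap.smul_apply, circL_apply, circL_apply, ← ltsCirc_eq_circ rfl hP hQ,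
    ← ltsCirc_eq_circ (Nat.add_comm q p) hQ hP]
  simp only [ltsBracket, Pi.sub_apply, Pi.smul_apply, neg_one_pow_smul_eq_sg, Nat.cast_mul,
    Units.smul_def]

end comparison

/-! ### `C^n(M, L)` as the homogeneous part of `fil 0` -/

section lift
variable {K L M : Type*} [Field K] [AddCommGroup L] [Module K L] [AddCommGroup M] [Module K M]

theorem LTSCochain.antisymm {n : ℕ} (f : LTSCochain K n M L) (X : Fin n → M × M) (i : Fin n)
    (x y z : M) : f.1 (Function.update X i (x, y)) z = -f.1 (Function.update X i (y, x)) z := by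
  obtain ⟨f, -, f2, f3, f4, -⟩ := f
  have h := f4 X i (x + y) z
  rw [(f2 X i (x + y) z).map_add, (f3 X i x z).map_add, (f3 X i y z).map_add, f4, f4, zero_add,
    add_zero] at h
  exact eq_neg_of_add_eq_zero_left h

/-- The pairs of `M`-components of a list of pairs, read from right to left. -/
def sndPairs (n : ℕ) (w : List ((L × M) × (L × M))) (i : Fin n) : M × M :=
  ((w.getD (n - 1 - i) 0).1.2, (w.getD (n - 1 - i) 0).2.2)

/-- Varying one letter of the list is updating one pair. The relation of its index to `|u|` shows
that the head is the last pair, the one in the cyclic identity. -/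
theorem sndPairs_middle {n : ℕ} {u v : List ((L × M) × (L × M))} (h : u.length + v.length + 1 = n) :
    ∃ (X : Fin n → M × M) (j : Fin n), (j : ℕ) + u.length + 1 = n ∧
      ∀ Y, sndPairs n (u ++ Y :: v) = Function.update X j (Y.1.2, Y.2.2) := by
  refine ⟨sndPairs n (u ++ 0 :: v), ⟨n - 1 - u.length, by omega⟩, by simp only; omega,
    fun Y => funext fun i => ?_⟩
  by_cases hi : n - 1 - (i : ℕ) = u.length
  · have : i = ⟨n - 1 - u.length, by omega⟩ := Fin.ext (by simp only; omega)
    rw [this, Function.update_self, ← this, sndPairs, hi]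
    simp
  · rw [Function.update_of_ne (fun hij => hi (by
      have := congrArg Fin.val hij
      simp only at this
      omega))]
    simp only [sndPairs]
    have : ∀ Y, (u ++ Y :: v).getD (n - 1 - i) 0 = (u ++ 0 :: v).getD (n - 1 - i) 0 := by
      intro Y
      rcases lt_or_gt_of_ne hi with h1 | h1
      · rw [List.getD_append _ _ _ _ h1, List.getD_append _ _ _ _ h1]
      · rw [List.getD_append_right _ _ _ _ h1.le, List.getD_append_right _ _ _ _ h1.le]
        obtain ⟨k, hk⟩ : ∃ k, n - 1 - (i : ℕ) - u.length = k + 1 := ⟨_, (Nat.succ_pred_eq_of_pos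
          (by omega)).symm⟩
        rw [hk, List.getD_cons_succ, List.getD_cons_succ]
    rw [this]

theorem sndPairs_reverse_ofFn {n : ℕ} (X : Fin n → (L × M) × (L × M)) :
    sndPairs n (List.ofFn X).reverse = fun i => ((X i).1.2, (X i).2.2) := by
  funext i
  have : (List.ofFn X).reverse.getD (n - 1 - i) 0 = X i := by
    rw [List.getD_eq_getElem _ _ (by simp; omega), List.getElem_reverse, List.getElem_ofFn]
    congr 1
    refine Fin.ext ?_
    simp only [List.length_ofFn]
    omega
  rw [sndPairs, this]

/-- An element of `Cⁿ(M, L)` as a function of lists. -/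
def liftFun {n : ℕ} (f : LTSCochain K n M L) (w : List ((L × M) × (L × M))) :
    Module.End K (L × M) :=
  if w.length = n then
    (LinearMap.inl K L M).comp (((f.2.1 (sndPairs n w)).mk' _).comp (LinearMap.snd K L M)) else 0

theorem liftFun_apply {n : ℕ} (f : LTSCochain K n M L) {w : List ((L × M) × (L × M))}
    (hw : w.length = n) (z : L × M) : liftFun f w z = (f.1 (sndPairs n w) z.2, 0) := by
  rw [liftFun, if_pos hw]
  rfl

theorem liftFun_of_ne {n : ℕ} (f : LTSCochain K n M L) {w : List ((L × M) × (L × M))}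
    (hw : w.length ≠ n) : liftFun f w = 0 := if_neg hw

theorem liftFun_mem {n : ℕ} (f : LTSCochain K n M L) : liftFun f ∈ cochains K (L × M) := by
  refine ⟨fun u v => ?_, fun x y z w => ?_⟩
  · by_cases h : u.length + v.length + 1 = n
    · obtain ⟨X, j, -, hX⟩ := sndPairs_middle h
      have hl : ∀ Y, (u ++ Y :: v).length = n := fun Y => by
        rw [← h, List.length_append, List.length_cons]; ring
      refine ⟨fun x x' y => ?_, fun c x y => ?_, fun x y => ?_⟩ <;>
        refine LinearMap.ext fun z => ?_
      · simp only [LinearMap.add_apply, liftFun_apply f (hl _), hX]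
        rw [Prod.snd_add, (f.2.2.1 X j _ _).map_add]
        simp
      · simp only [LinearMap.smul_apply, liftFun_apply f (hl _), hX]
        rw [Prod.smul_snd, (f.2.2.1 X j _ _).map_smul]
        simp
      · simp only [LinearMap.neg_apply, liftFun_apply f (hl _), hX]
        rw [LTSCochain.antisymm f]
        simp
    · have hl : ∀ Y, (u ++ Y :: v).length ≠ n := fun Y => by
        rw [List.length_append, List.length_cons]; omega
      simp only [liftFun_of_ne f (hl _)]
      exact zero_mem _
  · by_cases h : ([] : List ((L × M) × (L × M))).length + w.length + 1 = n
    · obtain ⟨X, j, hj, hX⟩ := sndPairs_middle h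
      have hl : ∀ Y : (L × M) × (L × M), (Y :: w).length = n := fun Y => by
        rw [← h]; simp
      simp only [List.nil_append] at hX
      simp only [liftFun_apply f (hl _), hX]
      have := f.2.2.2.2.2 X j (by simpa using hj) x.2 y.2 z.2
      simp [this]
    · have hl : ∀ Y : (L × M) × (L × M), (Y :: w).length ≠ n := fun Y => by
        simp only [List.length_nil] at h
        rw [List.length_cons]; omega
      simp [liftFun_of_ne f (hl _)]

variable (K L M) in
/-- The inclusion of `Cⁿ(M, L)` into the cochains of `L × M`. -/
def liftCoch (n : ℕ) : LTSCochain K n M L →ₗ[K] Coch K (L × M) where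
  toFun f := ⟨liftFun f, liftFun_mem f⟩
  map_add' f g := by
    refine Coch.ext fun w => LinearMap.ext fun z => ?_
    change liftFun (f + g) w z = liftFun f w z + liftFun g w z
    by_cases hw : w.length = n
    · simp [liftFun_apply _ hw]
    · simp [liftFun_of_ne _ hw]
  map_smul' c f := by
    refine Coch.ext fun w => LinearMap.ext fun z => ?_
    change liftFun (c • f) w z = c • liftFun f w z
    by_cases hw : w.length = n
    · simp [liftFun_apply _ hw]
    · simp [liftFun_of_ne _ hw]

theorem represents_liftCoch {n : ℕ} (f : LTSCochain K n M L) :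
    Represents (ltsLift f.1) (liftCoch K L M n f) := by
  refine ⟨fun w hw => liftFun_of_ne f (by exact_mod_cast hw), fun X z => ?_⟩
  exact ((liftFun_apply f (by simp) z).trans (by rw [sndPairs_reverse_ofFn]; rfl)).symm

theorem exists_of_pcount_pos {w : List ((L × M) × (L × M))} (h : 0 < pcount w) :
    ∃ u X v, w = u ++ X :: v ∧ (X.1.2 = 0 ∨ X.2.2 = 0) := by
  induction w with
  | nil => simp at h
  | cons Y w ih =>
    by_cases hY : Y.1.2 = 0 ∨ Y.2.2 = 0
    · exact ⟨[], Y, w, rfl, hY⟩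
    · push Not at hY
      rw [pcount, degSum_cons, lcount, lcount, if_neg hY.1, if_neg hY.2, add_zero, zero_add] at h
      obtain ⟨u, X, v, rfl, hX⟩ := ih h
      exact ⟨Y :: u, X, v, rfl, hX⟩

theorem liftCoch_mem_fil {n : ℕ} (f : LTSCochain K n M L) :
    liftCoch K L M n f ∈ fil K L M 0 := by
  intro w z
  change (_ → liftFun f w z = 0) ∧ (_ → (liftFun f w z).2 = 0)
  by_cases hw : w.length = n
  · refine ⟨fun h => ?_, fun _ => by rw [liftFun_apply f hw]⟩
    by_cases hz : z.2 = 0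
    · rw [liftFun_apply f hw, hz, (f.2.1 _).map_zero]
      rfl
    · rw [lcount, if_neg hz, add_zero] at h
      obtain ⟨u, X, v, rfl, hX⟩ := exists_of_pcount_pos h
      rw [List.length_append, List.length_cons] at hw
      obtain ⟨Y, j, -, hY⟩ := sndPairs_middle (u := u) (v := v) (n := n) (by omega)
      rw [liftFun_apply f (by simpa using hw), hY]
      rcases hX with hX | hX
      · rw [hX, (f.2.2.1 Y j _ _).map_zero]
        rfl
      · rw [hX, (f.2.2.2.1 Y j _ _).map_zero]
        rfl
  · simp [liftFun_of_ne f hw]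

/-- The projection of `L × M` to `M` as an endomorphism. -/
def projM (v : L × M) : L × M := (0, v.2)

theorem lcount_sub_projM (v : L × M) : lcount (v - projM v) = 1 := lcount_of_snd (by simp [projM])

/-- Each entry differs from its `M`-part by an element of `L`, and one entry in `L` is enough for
`F` to vanish. -/
theorem apply_projM_of_mem_fil {F : Coch K (L × M)} (hF : F ∈ fil K L M 0)
    (w : List ((L × M) × (L × M))) (z : L × M) :
    F.1 w z = F.1 (w.map (Prod.map projM projM)) (projM z) := by
  have h1 : ∀ w, F.1 w z = F.1 w (projM z) := by
    intro w
    rw [← sub_eq_zero, ← map_sub]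
    refine (hF _ _).1 ?_
    rw [lcount_sub_projM]
    have := pcount_nonneg w
    linarith
  have h2 : ∀ u X v, F.1 (u ++ X :: v) z = F.1 (u ++ Prod.map projM projM X :: v) z := by
    rintro u ⟨x, y⟩ v
    have hpos : ∀ x y : L × M, lcount x = 1 ∨ lcount y = 1 → F.1 (u ++ (x, y) :: v) z = 0 := by
      intro x y hxy
      refine (hF _ _).1 ?_
      rw [pcount, degSum_append, degSum_cons]
      have h1 := pcount_nonneg u
      have h2 := pcount_nonneg v
      have h3 := lcount_nonneg z
      have h4 := lcount_nonneg x
      have h5 := lcount_nonneg y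
      simp only
      rcases hxy with h | h <;> rw [h] <;> linarith
    have e1 := (F.2.1 u v).1 (x - projM x) (projM x) y
    have e2 := altBil_add_right (F.2.1 u v) (projM x) (y - projM y) (projM y)
    simp only [sub_add_cancel] at e1 e2
    rw [Prod.map_apply, e1, e2, LinearMap.add_apply, LinearMap.add_apply,
      hpos _ _ (Or.inl (lcount_sub_projM x)), hpos _ _ (Or.inr (lcount_sub_projM y)), zero_add,
      zero_add]
  have h3 : ∀ v u, F.1 (u ++ v) z = F.1 (u ++ v.map (Prod.map projM projM)) z := by
    intro v
    induction v with
    | nil => intro u; rfl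
    | cons X v ih =>
      intro u
      have := ih (u ++ [Prod.map projM projM X])
      simp only [List.append_assoc, List.singleton_append] at this
      rw [h2, this, List.map_cons]
  rw [← h1]
  exact h3 w []

theorem reverse_ofFn_update {G : Type*} {n : ℕ} (y : Fin n → G) (i : Fin n) :
    ∃ u v : List G, ((i : ℕ) + 1 = n → u = []) ∧
      ∀ X, (List.ofFn (Function.update y i X)).reverse = u ++ X :: v := by
  refine ⟨((List.ofFn y).drop (i + 1)).reverse, ((List.ofFn y).take i).reverse, fun h => ?_,
    fun X => ?_⟩
  · rw [List.drop_of_length_le (by simp [h]), List.reverse_nil]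
  · have : List.ofFn (Function.update y i X)
        = (List.ofFn y).take i ++ X :: (List.ofFn y).drop (i + 1) := by
      rw [← List.set_eq_take_cons_drop X (by simp)]
      refine List.ext_getElem (by simp) fun k h1 h2 => ?_
      simp only [List.getElem_ofFn, List.getElem_set, Function.update_apply, Fin.ext_iff,
        eq_comm (a := k)]
    rw [this, List.reverse_append, List.reverse_cons]
    simp

/-- A homogeneous cochain that only sees `M` and has values in `L` is an element of `Cⁿ(M, L)`. -/
theorem exists_liftCoch_eq [CharZero K] {n : ℕ} {F : Coch K (L × M)} (hF : F ∈ fil K L M 0)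
    (hn : IsDeg n F.1) : ∃ T : LTSCochain K n M L, liftCoch K L M n T = F := by
  let inc : M × M → (L × M) × (L × M) := fun X => ((0, X.1), (0, X.2))
  let T : PairFun n M L := fun X m => (F.1 (List.ofFn fun i => inc (X i)).reverse (0, m)).1
  have hup : ∀ (X : Fin n → M × M) (i : Fin n), ∃ u v, ((i : ℕ) + 1 = n → u = []) ∧
      ∀ Y m, T (Function.update X i Y) m = (F.1 (u ++ inc Y :: v) (0, m)).1 := by
    intro X i
    obtain ⟨u, v, hu, h⟩ := reverse_ofFn_update (fun i => inc (X i)) i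
    refine ⟨u, v, hu, fun Y m => ?_⟩
    rw [← h]
    have : (fun k => inc (Function.update X i Y k))
        = Function.update (fun k => inc (X k)) i (inc Y) := by
      funext k
      by_cases hk : k = i
      · subst hk; simp
      · simp [hk]
    simp only [T, this]
  have hadd : ∀ m m' : M, ((0, m + m') : L × M) = (0, m) + (0, m') := by simp
  have hsmul : ∀ (c : K) (m : M), ((0, c • m) : L × M) = c • (0, m) := by simp
  have hT : T ∈ LTSCochain K n M L := by
    refine ⟨fun X => ⟨fun m m' => ?_, fun c m => ?_⟩, fun X i y z => ?_, fun X i x z => ?_,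
      fun X i x z => ?_, fun X i hi x y z => ?_⟩
    · simp only [T]; rw [hadd, map_add]; rfl
    · simp only [T]; rw [hsmul, map_smul]; rfl
    · obtain ⟨u, v, -, h⟩ := hup X i
      refine ⟨fun m m' => ?_, fun c m => ?_⟩
      · simp only [h, inc]
        rw [hadd]
        exact congrArg (fun G : Module.End K (L × M) => (G (0, z)).1)
          ((F.2.1 u v).1 (0, m) (0, m') (0, y))
      · simp only [h, inc]
        rw [hsmul]
        exact congrArg (fun G : Module.End K (L × M) => (G (0, z)).1)
          ((F.2.1 u v).2.1 c (0, m) (0, y))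
    · obtain ⟨u, v, -, h⟩ := hup X i
      refine ⟨fun m m' => ?_, fun c m => ?_⟩
      · simp only [h, inc]
        rw [hadd, altBil_add_right (F.2.1 u v) (0, x) (0, m) (0, m')]; rfl
      · simp only [h, inc]
        rw [hsmul, altBil_smul_right (F.2.1 u v) c (0, x) (0, m)]; rfl
    · obtain ⟨u, v, -, h⟩ := hup X i
      have h2 := (F.2.1 u v).2.2 (0, x) (0, x)
      -- Cochains of `L × M` are only required to be antisymmetric; alternation follows because 2 is
      -- invertible.
      have h3 : F.1 (u ++ inc (x, x) :: v) = 0 := by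
        have h4 : (2 : K) • F.1 (u ++ inc (x, x) :: v) = 0 := by
          rw [two_smul]
          nth_rewrite 1 [show F.1 (u ++ inc (x, x) :: v) = -F.1 (u ++ inc (x, x) :: v) from h2]
          exact neg_add_cancel _
        exact (smul_eq_zero.1 h4).resolve_left two_ne_zero
      rw [h, h3]
      rfl
    · obtain ⟨u, v, hu, h⟩ := hup X i
      obtain rfl := hu hi
      simp only [h]
      exact congrArg Prod.fst (F.2.2 (0, x) (0, y) (0, z) v)
  refine ⟨⟨T, hT⟩, Coch.ext fun w => LinearMap.ext fun z => ?_⟩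
  change liftFun ⟨T, hT⟩ w z = F.1 w z
  by_cases hw : w.length = n
  · rw [liftFun_apply _ hw, apply_projM_of_mem_fil hF]
    have hl : (List.ofFn fun i => inc (sndPairs n w i)).reverse
        = w.map (Prod.map projM projM) := by
      refine List.ext_getElem (by simp [hw]) fun k h1 h2 => ?_
      rw [List.getElem_reverse, List.getElem_ofFn, List.getElem_map]
      have hk : k < w.length := by simpa using h2
      have hj : n - 1 - ((List.ofFn fun i => inc (sndPairs n w i)).length - 1 - k) = k := by
        rw [List.length_ofFn]; omega
      rw [sndPairs, Fin.val_mk, hj, List.getD_eq_getElem w 0 hk]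
      rfl
    have h0 := (hF (w.map (Prod.map projM projM)) (projM z)).2
      (add_nonneg (pcount_nonneg _) (lcount_nonneg _))
    refine Prod.ext ?_ h0.symm
    simp only [T, hl]
    rfl
  · rw [liftFun_of_ne _ hw, hn w (by exact_mod_cast hw)]

end lift

/-! ### The grading and the embedding of the direct sum -/

section grading
variable {K L M : Type*} [Field K] [AddCommGroup L] [Module K L] [AddCommGroup M] [Module K M]

theorem lof_mem_ltsGrading {n : ℕ} (f : LTSCochain K n M L) : ltsOf f ∈ ltsGrading K M L n := by
  intro m hm
  refine DirectSum.of_eq_of_ne _ _ _ fun h => hm ?_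
  rw [h]

theorem coeAddMonoidHom_ltsGrading_apply (x : ⨁ k, ltsGrading K M L k) (n : ℕ) :
    DirectSum.coeAddMonoidHom (ltsGrading K M L) x n = (x (n : ℤ)).1 n := by
  induction x using DirectSum.induction_on with
  | zero => rw [map_zero]; rfl
  | of k f =>
    rw [DirectSum.coeAddMonoidHom_of]
    by_cases h : (n : ℤ) = k
    · subst h
      rw [DirectSum.of_eq_same]
    · rw [DirectSum.of_eq_of_ne _ _ _ h, f.2 n h]
      rfl
  | add x y hx hy => rw [map_add, DirectSum.add_apply, hx, hy]; rfl

theorem isInternal_ltsGrading : DirectSum.IsInternal (ltsGrading K M L) := by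
  constructor
  · refine fun x y h => DFinsupp.ext fun k => Subtype.ext (DFinsupp.ext fun n => ?_)
    by_cases hn : (n : ℤ) = k
    · subst hn
      have := congrArg (fun z : LTSCochainSpace K M L => z n) h
      exact (coeAddMonoidHom_ltsGrading_apply x n).symm.trans
        (this.trans (coeAddMonoidHom_ltsGrading_apply y n))
    · exact ((x k).2 n hn).trans ((y k).2 n hn).symm
  · intro x
    induction x using DirectSum.induction_on with
    | zero => exact ⟨0, map_zero _⟩
    | of n f =>
      exact ⟨DirectSum.of (fun k => ltsGrading K M L k) n ⟨ltsOf f, lof_mem_ltsGrading f⟩,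
        DirectSum.coeAddMonoidHom_of ..⟩
    | add x y hx hy =>
      obtain ⟨a, rfl⟩ := hx
      obtain ⟨b, rfl⟩ := hy
      exact ⟨a + b, map_add _ _ _⟩

variable (K L M) in
/-- The inclusion of `C^*(M, L)` into the cochains of `L × M`. -/
def totalLift : LTSCochainSpace K M L →ₗ[K] Coch K (L × M) :=
  DirectSum.toModule K ℕ (Coch K (L × M)) (liftCoch K L M)

theorem totalLift_ltsOf {n : ℕ} (f : LTSCochain K n M L) :
    totalLift K L M (ltsOf f) = liftCoch K L M n f := DirectSum.toModule_lof ..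

theorem totalLift_apply (x : LTSCochainSpace K M L) (w : List ((L × M) × (L × M))) :
    (totalLift K L M x).1 w = (liftCoch K L M w.length (x w.length)).1 w := by
  induction x using DirectSum.induction_on with
  | zero => rw [map_zero, DirectSum.zero_apply, map_zero]
  | of n f =>
    refine (congrArg (fun F : Coch K (L × M) => F.1 w) (totalLift_ltsOf f)).trans ?_
    by_cases h : n = w.length
    · subst h
      rw [DirectSum.of_eq_same]
    · rw [DirectSum.of_eq_of_ne _ _ _ (Ne.symm h), map_zero]
      exact liftFun_of_ne f (Ne.symm h)
  | add x y hx hy =>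
    rw [map_add, Coch.add_val, hx, hy, DirectSum.add_apply, map_add, Coch.add_val]

theorem totalLift_mem_fil (x : LTSCochainSpace K M L) : totalLift K L M x ∈ fil K L M 0 := by
  intro w z
  rw [totalLift_apply]
  exact liftCoch_mem_fil _ w z

theorem isDeg_totalLift {x : LTSCochainSpace K M L} {d : ℤ} (hx : x ∈ ltsGrading K M L d) :
    IsDeg d (totalLift K L M x).1 := by
  intro w hw
  rw [totalLift_apply, hx _ hw, map_zero]
  rfl

theorem liftCoch_injective (n : ℕ) : Function.Injective (liftCoch K L M n) := by
  rw [← LinearMap.ker_eq_bot, LinearMap.ker_eq_bot']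
  intro f hf
  refine Subtype.ext (funext fun X => funext fun m => ?_)
  have h := (represents_liftCoch f).eq (fun i => ((0, (X i).1), (0, (X i).2))) (0, m)
  rw [hf] at h
  exact congrArg Prod.fst h

theorem totalLift_injective : Function.Injective (totalLift K L M) := by
  refine fun x y h => DFinsupp.ext fun n => liftCoch_injective n (Coch.ext fun w => ?_)
  by_cases hw : w.length = n
  · subst hw
    exact (totalLift_apply x w).symm.trans ((congrArg (fun F => F.1 w) h).trans
      (totalLift_apply y w))
  · exact (liftFun_of_ne _ hw).trans (liftFun_of_ne _ hw).symm

theorem exists_totalLift_eq [CharZero K] {d : ℤ} {F : Coch K (L × M)} (hF : F ∈ fil K L M 0)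
    (hd : IsDeg d F.1) : ∃ x ∈ ltsGrading K M L d, totalLift K L M x = F := by
  rcases lt_or_ge d 0 with h | h
  -- No list has negative length, so a cochain of negative degree is zero.
  · refine ⟨0, zero_mem _, ?_⟩
    rw [map_zero]
    exact (Coch.ext fun w => hd w (by omega)).symm
  · lift d to ℕ using h
    obtain ⟨T, hT⟩ := exists_liftCoch_eq hF hd
    exact ⟨ltsOf T, lof_mem_ltsGrading T, (totalLift_ltsOf T).trans hT⟩

variable (K L M) in
/-- A linear left inverse of the inclusion of `C^*(M, L)`. -/
noncomputable def totalRet : Coch K (L × M) →ₗ[K] LTSCochainSpace K M L :=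
  Function.invFun (fun g => g ∘ₗ totalLift K L M) LinearMap.id

theorem exists_leftInverse_of_injective {V W : Type*} [AddCommGroup V] [Module K V]
    [AddCommGroup W] [Module K W] (f : V →ₗ[K] W) (hf : Function.Injective f) :
    ∃ g : W →ₗ[K] V, g ∘ₗ f = LinearMap.id :=
  f.exists_leftInverse_of_injective (LinearMap.ker_eq_bot.2 hf)

theorem totalRet_totalLift (x : LTSCochainSpace K M L) :
    totalRet K L M (totalLift K L M x) = x := by
  have h := exists_leftInverse_of_injective (V := LTSCochainSpace K M L) (totalLift K L M)
    totalLift_injective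
  exact LinearMap.congr_fun (Function.invFun_eq (f := fun g => g ∘ₗ totalLift K L M) h) x

end grading

/-! ### Higher derived brackets and the `L_∞` identities -/

section operations
variable {K L M : Type*} [Field K] [AddCommGroup L] [Module K L] [AddCommGroup M] [Module K M]

/-- The multilinear map `(a₁, …, aₖ) ↦ [[Δ, a₁], …, aₖ]`. -/
def iterMul {V : Type*} [AddCommGroup V] [Module K V] (Δ : Coch K V) :
    ∀ k : ℕ, MultilinearMap K (fun _ : Fin k => Coch K V) (Coch K V)
  | 0 => MultilinearMap.constOfIsEmpty K _ Δ
  | k + 1 => MultilinearMap.uncurryRight ((bra K V).compMultilinearMap (iterMul Δ k))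

/-- The degrees `d` are labels that do not affect `iter`; any choice is allowed. -/
theorem iterMul_apply {V : Type*} [AddCommGroup V] [Module K V] (Δ : Coch K V) :
    ∀ (k : ℕ) (d : Fin k → ℤ) (x : Fin k → Coch K V),
      iterMul Δ k x = iter Δ (List.ofFn fun i => (d i, x i)).reverse
  | 0, _, _ => by simp [iterMul, iter]
  | k + 1, d, x => by
    rw [reverse_ofFn_succ, iter, ← iterMul_apply Δ k (fun i => d i.castSucc)]
    rfl

variable [CharZero K]

/-- Induction on the number of letters: `iter_middle` brings the last letter to the outermost
bracket, with exactly the sign that `koszulSign_insPerm'` adds. -/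
theorem iter_reverse_ofFn_perm {Δ : Coch K (L × M)} {m : ℤ} (hΔ : IsDeg m Δ.1) :
    ∀ (n : ℕ) (y : Fin n → ℤ × Coch K (L × M)), Good (List.ofFn y).reverse →
      ∀ σ : Equiv.Perm (Fin n), iter Δ (List.ofFn fun a => y (σ a)).reverse
        = (koszulSign (fun a => (y a).1) σ : ℤ) • iter Δ (List.ofFn y).reverse
  | 0, y, _, σ => by
    simp [koszulSign]
  | n + 1, y, hy, σ => by
    obtain ⟨⟨j, τ⟩, rfl⟩ := (insPerm_bijective (n := n)).2 σ
    have hperm : ((List.ofFn fun a => y (τ a).castSucc)).Perm (List.ofFn fun a => y a.castSucc) :=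
      Equiv.Perm.ofFn_comp_perm τ fun a => y a.castSucc
    rw [reverse_ofFn_succ] at hy
    have hg := good_cons.1 hy
    simp only
    rw [koszulSign_insPerm' Prod.fst y, ofFn_insPerm]
    set ℓ := List.ofFn fun a => y (τ a).castSucc with hℓ
    have hrev : (ℓ.drop j).reverse ++ (ℓ.take j).reverse = ℓ.reverse := by
      rw [← List.reverse_append, List.take_append_drop]
    have hp : (ℓ.take j ++ y (Fin.last n) :: ℓ.drop j).reverse
        = (ℓ.drop j).reverse ++ y (Fin.last n) :: (ℓ.take j).reverse := by simp
    rw [hp, iter_middle hΔ, hrev, iter, iter_reverse_ofFn_perm hΔ n _ hg.2 τ, reverse_ofFn_succ,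
      iter, map_zsmul, LinearMap.smul_apply, smul_smul,
      degSum_perm Prod.fst (List.reverse_perm (ℓ.drop j)), Units.val_mul, mul_comm]
    rw [hrev]
    exact good_cons.2 ⟨hg.1, hg.2.perm (((List.reverse_perm _).trans hperm).trans
      (List.reverse_perm _).symm)⟩

end operations

section transfer
variable {K L M V : Type*} [Field K] [CharZero K] [AddCommGroup L] [Module K L] [AddCommGroup M]
  [Module K M] [AddCommGroup V] [Module K V] {𝒜 : ℤ → Submodule K V}
  {ι : V →ₗ[K] Coch K (L × M)} {ρ : Coch K (L × M) →ₗ[K] V} {Δ : ℕ → Coch K (L × M)}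

/-- The operations `(x₁, …, xₙ) ↦ ρ [[Δₙ, ι x₁], …, ι xₙ]`. -/
def derivedOp (ι : V →ₗ[K] Coch K (L × M)) (ρ : Coch K (L × M) →ₗ[K] V)
    (Δ : ℕ → Coch K (L × M)) (n : ℕ) : MultilinearMap K (fun _ : Fin n => V) V :=
  ρ.compMultilinearMap ((iterMul (Δ n) n).compLinearMap fun _ => ι)

theorem derivedOp_apply (n : ℕ) (d : Fin n → ℤ) (x : Fin n → V) :
    derivedOp ι ρ Δ n x = ρ (iter (Δ n) (List.ofFn fun i => (d i, ι (x i))).reverse) :=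
  congrArg ρ (iterMul_apply (Δ n) n d fun i => ι (x i))

theorem derivedOp_eq_zero {n : ℕ} (h : Δ n = 0) : derivedOp ι ρ Δ n = 0 := by
  ext x
  rw [derivedOp_apply n 0, h, iter_zero, map_zero]
  rfl

theorem good_ofFn (hι : ∀ x, ι x ∈ fil K L M 0) (hdeg : ∀ d, ∀ x ∈ 𝒜 d, IsDeg d (ι x).1)
    {n : ℕ} {d : Fin n → ℤ} {x : Fin n → V} (hx : ∀ i, x i ∈ 𝒜 (d i)) :
    Good (List.ofFn fun i => (d i, ι (x i))).reverse := by
  intro a ha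
  rw [List.mem_reverse, List.mem_ofFn] at ha
  obtain ⟨i, rfl⟩ := ha
  exact ⟨hdeg _ _ (hx i), hι _⟩

/-- Summand of the Jacobi identity. -/
theorem derivedOp_cons (hρ : ∀ d F, F ∈ fil K L M 0 → IsDeg d F.1 → ι (ρ F) = F)
    (h1 : ∀ n, IsDeg 1 (Δ n).1) (he : ∀ n : ℕ, Δ n ∈ fil K L M n) {i m : ℕ}
    (d : Fin i → ℤ) (x : Fin i → V) (d' : Fin m → ℤ) (x' : Fin m → V)
    (hg : Good (List.ofFn fun a => (d a, ι (x a))).reverse) :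
    derivedOp ι ρ Δ (m + 1) (Fin.cons (derivedOp ι ρ Δ i x) x')
      = ρ (iter (bra K (L × M) (Δ (m + 1))
          (iter (Δ i) (List.ofFn fun a => (d a, ι (x a))).reverse))
          (List.ofFn fun a => (d' a, ι (x' a))).reverse) := by
  have h0 := iter_mem_fil (h1 i) (he i) hg
  rw [List.length_reverse, List.length_ofFn, sub_self] at h0
  rw [derivedOp_apply (m + 1) (Fin.cons 0 d'), derivedOp_apply i d]
  congr 1
  -- The first argument is last in the reversed list, so it enters the innermost bracket with `Δ (m
  -- + 1)`.
  rw [List.ofFn_succ, List.reverse_cons, iter_append]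
  simp only [Fin.cons_zero, Fin.cons_succ, iter, hρ _ _ h0 (isDeg_iter (h1 i) hg)]

/-- General form of the construction: a family of commuting degree-one elements `Δ n` of `fil n`
yields operations on `V`. The index `n` is both the arity and the filtration level, so `n` brackets
land in `fil 0`, where `ρ` inverts `ι` on homogeneous elements. -/
theorem isLInfinityAlgebra_derivedOp (hint : DirectSum.IsInternal 𝒜)
    (hι : ∀ x, ι x ∈ fil K L M 0) (hdeg : ∀ d, ∀ x ∈ 𝒜 d, IsDeg d (ι x).1)
    (hρ : ∀ d F, F ∈ fil K L M 0 → IsDeg d F.1 → ι (ρ F) = F)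
    (hρ' : ∀ d F, F ∈ fil K L M 0 → IsDeg d F.1 → ρ F ∈ 𝒜 d)
    (h1 : ∀ n, IsDeg 1 (Δ n).1) (he : ∀ n : ℕ, Δ n ∈ fil K L M n)
    (h0 : ∀ m n, bra K (L × M) (Δ m) (Δ n) = 0) :
    IsLInfinityAlgebra K V 𝒜 (derivedOp ι ρ Δ) where
  graded := hint
  degree_one n _ d x hx := by
    have hg := good_ofFn hι hdeg hx
    have hf := iter_mem_fil (h1 n) (he n) hg
    have hd := isDeg_iter (h1 n) hg
    rw [List.length_reverse, List.length_ofFn, sub_self] at hf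
    rw [degSum_perm _ (List.reverse_perm _)] at hd
    have hs : degSum Prod.fst (List.ofFn fun i => (d i, ι (x i))) = ∑ i, d i := by
      rw [degSum, List.map_ofFn, List.sum_ofFn]
      rfl
    rw [hs] at hd
    rw [derivedOp_apply n d]
    exact hρ' _ _ hf hd
  graded_symm n _ d x hx σ := by
    rw [derivedOp_apply n d x, derivedOp_apply n (fun i => d (σ i)), ← map_zsmul]
    exact congrArg ρ (iter_reverse_ofFn_perm (h1 n) n _ (good_ofFn hι hdeg hx) σ)
  jacobi n _ d x hx := by
    have hg := good_ofFn hι hdeg hx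
    set y : Fin n → ℤ × Coch K (L × M) := fun i => (d i, ι (x i)) with hy
    let J : ℕ → ℕ → Coch K (L × M) := fun i j => ksplit Prod.fst (fun u v => if u.length = i then
        iter (bra K (L × M) (Δ j) (iter (Δ i) u)) v else 0) (List.ofFn y).reverse
    have hJ : ∀ i j, i + j = n + 1 → J i j + J j i = 0 := fun i j hij =>
      jacobi_of_bra_eq_zero (h1 i) (h1 j) (he i) (he j) (h0 i j) hg (by simp [hij])
    have hsum : ∑ i : Fin n, J (i + 1) (n - (i + 1) + 1) = 0 := by
      -- The relation `J i j + J j i = 0` comes in pairs. Reversing the order of summation exchanges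
      -- inner and outer arity, so twice the sum vanishes.
      have h2 : (2 : K) • ∑ i : Fin n, J (i + 1) (n - (i + 1) + 1) = 0 := by
        rw [two_smul]
        nth_rewrite 2 [← Equiv.sum_comp Fin.revPerm]
        rw [← Finset.sum_add_distrib]
        refine Finset.sum_eq_zero fun i _ => ?_
        have hi := i.2
        convert hJ (i + 1) (n - (i + 1) + 1) (by omega) using 2
        rw [Fin.revPerm_apply, Fin.val_rev]
        congr 1
        all_goals omega
      exact (smul_eq_zero.1 h2).resolve_left two_ne_zero
    rw [← map_zero ρ, ← hsum, map_sum]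
    refine Finset.sum_congr rfl fun i _ => ?_
    have hs := sum_isShuffle Prod.fst (fun u v =>
        iter (bra K (L × M) (Δ (n - (i + 1) + 1)) (iter (Δ (i + 1)) u)) v) (i + 1) i.2 y
    simp only [J]
    rw [← hs, map_sum]
    refine Finset.sum_congr rfl fun σ _ => ?_
    rw [Units.smul_def, map_zsmul]
    congr 1
    have ht : (List.ofFn fun a => y (σ a)).take (i + 1)
        = List.ofFn fun a : Fin (i + 1) => y (σ (Fin.castLE i.2 a)) := by
      refine List.ext_getElem (by simp only [List.length_take, List.length_ofFn]; omega) fun k h1 h2 => ?_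
      simp only [List.getElem_take, List.getElem_ofFn]
      rfl
    have hd : (List.ofFn fun a => y (σ a)).drop (i + 1)
        = List.ofFn fun b : Fin (n - (i + 1)) => y (σ ⟨(i : ℕ) + 1 + b, by omega⟩) := by
      refine List.ext_getElem (by simp) fun k h1 h2 => ?_
      simp [List.getElem_ofFn]
    rw [ht, hd]
    exact derivedOp_cons hρ h1 he _ _ _ _ (good_ofFn hι hdeg fun a => hx _)

end transfer

/-! ### The operations defined by `π + θ` and `H` -/

section main
variable {K L M : Type*} [Field K] [AddCommGroup L] [Module K L] [AddCommGroup M] [Module K M]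
  {br : L →ₗ[K] L →ₗ[K] L →ₗ[K] L} {θ : L →ₗ[K] L →ₗ[K] Module.End K M}
  {H : L →ₗ[K] L →ₗ[K] L →ₗ[K] M}

theorem represents_semiCoch (hbr : IsLieTripleSystem br) :
    Represents (ltsSemidirect br θ) (semiCoch hbr θ) :=
  ⟨isDeg_single _, fun X z => by
    rw [List.ofFn_succ, List.ofFn_zero]
    rfl⟩

theorem represents_twistCoch (hH : IsLTSThreeCocycle br θ H) :
    Represents (ltsTwist H) (twistCoch hH) :=
  ⟨isDeg_single _, fun X z => by
    rw [List.ofFn_succ, List.ofFn_zero]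
    rfl⟩

/-- The sequence `0, 0, 0, π + θ, H, 0, …`. -/
def curvature (hbr : IsLieTripleSystem br) (hH : IsLTSThreeCocycle br θ H) : ℕ → Coch K (L × M)
  | 3 => semiCoch hbr θ
  | 4 => twistCoch hH
  | _ => 0

theorem curvature_cases (hbr : IsLieTripleSystem br) (hH : IsLTSThreeCocycle br θ H) (n : ℕ) :
    (n = 3 ∧ curvature hbr hH n = semiCoch hbr θ) ∨ (n = 4 ∧ curvature hbr hH n = twistCoch hH) ∨
      curvature hbr hH n = 0 := by
  match n with
  | 3 => exact Or.inl ⟨rfl, rfl⟩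
  | 4 => exact Or.inr (Or.inl ⟨rfl, rfl⟩)
  | 0 | 1 | 2 | _ + 5 => exact Or.inr (Or.inr rfl)

theorem curvature_eq_zero (hbr : IsLieTripleSystem br) (hH : IsLTSThreeCocycle br θ H) {n : ℕ}
    (h3 : n ≠ 3) (h4 : n ≠ 4) : curvature hbr hH n = 0 := by
  simpa [h3, h4] using curvature_cases hbr hH n

theorem isDeg_curvature (hbr : IsLieTripleSystem br) (hH : IsLTSThreeCocycle br θ H) (n : ℕ) :
    IsDeg 1 (curvature hbr hH n).1 := by
  rcases curvature_cases hbr hH n with ⟨-, h⟩ | ⟨-, h⟩ | h <;> rw [h]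
  · exact isDeg_single _
  · exact isDeg_single _
  · exact fun _ _ => rfl

theorem curvature_mem_fil (hbr : IsLieTripleSystem br) (hH : IsLTSThreeCocycle br θ H) (n : ℕ) :
    curvature hbr hH n ∈ fil K L M n := by
  rcases curvature_cases hbr hH n with ⟨rfl, h⟩ | ⟨rfl, h⟩ | h <;> rw [h]
  · exact semiCoch_mem_fil hbr
  · exact twistCoch_mem_fil hH
  · exact zero_mem _

theorem bra_curvature [CharZero K] (hbr : IsLieTripleSystem br) (hθ : IsLTSRepresentation br θ)
    (hH : IsLTSThreeCocycle br θ H) (m n : ℕ) :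
    bra K (L × M) (curvature hbr hH m) (curvature hbr hH n) = 0 := by
  have hc : bra K (L × M) (twistCoch hH) (semiCoch hbr θ) = 0 := by
    rw [bra_comm (isDeg_single _) (isDeg_single _), bra_semiCoch_twistCoch hbr hH, smul_zero]
    exact neg_zero
  rcases curvature_cases hbr hH m with ⟨-, h⟩ | ⟨-, h⟩ | h <;>
  rcases curvature_cases hbr hH n with ⟨-, h'⟩ | ⟨-, h'⟩ | h' <;> rw [h, h'] <;>
  simp [bra_semiCoch_semiCoch hbr hθ, bra_semiCoch_twistCoch hbr hH, bra_twistCoch_twistCoch hH, hc]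

variable {V : Type*} [AddCommGroup V] [Module K V] {ι : V →ₗ[K] Coch K (L × M)}
  {ρ : Coch K (L × M) →ₗ[K] V}

/-- After `k` brackets the filtration level of `Δ k` is used up, so the iterated bracket is the lift
of some `T` in `C^m(M, L)`, and `ρ` returns this `T`. -/
theorem exists_derivedOp_eq [CharZero K] {of : ∀ n, LTSCochain K n M L → V}
    (hof : ∀ n f, ι (of n f) = liftCoch K L M n f) (hρι : ∀ x, ρ (ι x) = x)
    {Δ : ℕ → Coch K (L × M)} {k m : ℕ} {d : Fin k → ℤ} {x : Fin k → V}
    {w : List (ℤ × Coch K (L × M))} (hw : (List.ofFn fun i => (d i, ι (x i))).reverse = w)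
    (h1 : IsDeg 1 (Δ k).1) (he : Δ k ∈ fil K L M k)
    (hg : Good w) {f : PairFun m (L × M) (L × M)} (hf : Represents f (iter (Δ k) w)) :
    ∃ T : LTSCochain K m M L, derivedOp ι ρ Δ k x = of m T ∧ ltsLift T.1 = f := by
  have h0 := iter_mem_fil h1 he hg
  rw [← hw, List.length_reverse, List.length_ofFn, sub_self, hw] at h0
  obtain ⟨T, hT⟩ := exists_liftCoch_eq h0 hf.isDeg
  refine ⟨T, ?_, ?_⟩
  · rw [derivedOp_apply k d, hw, ← hT, ← hof, hρι]
  · funext X z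
    rw [hf.eq, (represents_liftCoch T).eq, hT]

theorem Represents.iter_nil {n : ℕ} {f : PairFun n (L × M) (L × M)} {F : Coch K (L × M)}
    (hf : Represents f F) : Represents f (iter F []) := by
  rw [iter]
  exact hf

theorem Represents.iter_cons [CharZero K] {m n : ℕ} {f : PairFun m (L × M) (L × M)}
    {F : Coch K (L × M)} {w : List (ℤ × Coch K (L × M))} (hf : Represents f (iter F w))
    (g : LTSCochain K n M L) :
    Represents (ltsBracket f (ltsLift g.1)) (iter F (((n : ℤ), liftCoch K L M n g) :: w)) := by
  rw [iter]
  exact hf.bracket (represents_liftCoch g)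

theorem good_liftCoch_cons [CharZero K] {n : ℕ} (f : LTSCochain K n M L)
    {w : List (ℤ × Coch K (L × M))} (hw : Good w) :
    Good (((n : ℤ), liftCoch K L M n f) :: w) :=
  good_cons.2 ⟨⟨(represents_liftCoch f).isDeg, liftCoch_mem_fil f⟩, hw⟩

theorem good_nil : Good ([] : List (ℤ × Coch K (L × M))) := by simp [Good]

theorem exists_derivedOp_three_eq [CharZero K] {of : ∀ n, LTSCochain K n M L → V}
    (hof : ∀ n f, ι (of n f) = liftCoch K L M n f) (hρι : ∀ x, ρ (ι x) = x)
    {Δ : ℕ → Coch K (L × M)} (he : Δ 3 ∈ fil K L M 3) {f : PairFun 1 (L × M) (L × M)}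
    (hf : Represents f (Δ 3)) (p q r : ℕ) (P : LTSCochain K p M L) (Q : LTSCochain K q M L)
    (R : LTSCochain K r M L) (x : Fin 3 → V) (hP : x 0 = of p P) (hQ : x 1 = of q Q)
    (hR : x 2 = of r R) :
    ∃ T : LTSCochain K (1 + p + q + r) M L,
      derivedOp ι ρ Δ 3 x = of _ T ∧
      ltsLift T.1 = ltsBracket (ltsBracket (ltsBracket f (ltsLift P.1)) (ltsLift Q.1))
        (ltsLift R.1) := by
  have hl : (List.ofFn fun i : Fin 3 => ((![p, q, r] i : ℤ), ι (x i))).reverse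
      = [((r : ℤ), liftCoch K L M r R), ((q : ℤ), liftCoch K L M q Q),
        ((p : ℤ), liftCoch K L M p P)] := by
    rw [← hof, ← hof, ← hof, ← hP, ← hQ, ← hR]
    rfl
  have hg := good_liftCoch_cons R (good_liftCoch_cons Q
    (good_liftCoch_cons P good_nil))
  have h := ((hf.iter_nil.iter_cons P).iter_cons Q).iter_cons R
  exact exists_derivedOp_eq hof hρι hl hf.isDeg he hg h

theorem exists_derivedOp_four_eq [CharZero K] {of : ∀ n, LTSCochain K n M L → V}
    (hof : ∀ n f, ι (of n f) = liftCoch K L M n f) (hρι : ∀ x, ρ (ι x) = x)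
    {Δ : ℕ → Coch K (L × M)} (he : Δ 4 ∈ fil K L M 4) {f : PairFun 1 (L × M) (L × M)}
    (hf : Represents f (Δ 4)) (p q r s : ℕ) (P : LTSCochain K p M L) (Q : LTSCochain K q M L)
    (R : LTSCochain K r M L) (S : LTSCochain K s M L) (x : Fin 4 → V) (hP : x 0 = of p P)
    (hQ : x 1 = of q Q) (hR : x 2 = of r R) (hS : x 3 = of s S) :
    ∃ T : LTSCochain K (1 + p + q + r + s) M L,
      derivedOp ι ρ Δ 4 x = of _ T ∧
      ltsLift T.1 = ltsBracket (ltsBracket (ltsBracket (ltsBracket f (ltsLift P.1))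
        (ltsLift Q.1)) (ltsLift R.1)) (ltsLift S.1) := by
  have hl : (List.ofFn fun i : Fin 4 => ((![p, q, r, s] i : ℤ), ι (x i))).reverse
      = [((s : ℤ), liftCoch K L M s S), ((r : ℤ), liftCoch K L M r R),
        ((q : ℤ), liftCoch K L M q Q), ((p : ℤ), liftCoch K L M p P)] := by
    rw [← hof, ← hof, ← hof, ← hof, ← hP, ← hQ, ← hR, ← hS]
    rfl
  have hg := good_liftCoch_cons S (good_liftCoch_cons R
    (good_liftCoch_cons Q (good_liftCoch_cons P good_nil)))
  have h := (((hf.iter_nil.iter_cons P).iter_cons Q).iter_cons R).iter_cons S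
  exact exists_derivedOp_eq hof hρι hl hf.isDeg he hg h

theorem exists_isLInfinityAlgebra [CharZero K] (hbr : IsLieTripleSystem br)
    (hθ : IsLTSRepresentation br θ) (hH : IsLTSThreeCocycle br θ H) {𝒜 : ℤ → Submodule K V}
    (hint : DirectSum.IsInternal 𝒜) (of : ∀ n, LTSCochain K n M L → V)
    (hof : ∀ n f, ι (of n f) = liftCoch K L M n f)
    (hι : ∀ x, ι x ∈ fil K L M 0) (hdeg : ∀ d, ∀ x ∈ 𝒜 d, IsDeg d (ι x).1)
    (hρι : ∀ x, ρ (ι x) = x) (hρ : ∀ d F, F ∈ fil K L M 0 → IsDeg d F.1 → ∃ x ∈ 𝒜 d, ι x = F) :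
    ∃ l : ∀ k : ℕ, MultilinearMap K (fun _ : Fin k => V) V,
      IsLInfinityAlgebra K V 𝒜 l ∧
      l 1 = 0 ∧
      l 2 = 0 ∧
      (∀ (p q r : ℕ) (P : LTSCochain K p M L) (Q : LTSCochain K q M L) (R : LTSCochain K r M L),
        ∃ T : LTSCochain K (1 + p + q + r) M L,
          l 3 ![of p P, of q Q, of r R] = of _ T ∧
          ltsLift T.1 = ltsBracket (ltsBracket (ltsBracket (ltsSemidirect br θ)
            (ltsLift P.1)) (ltsLift Q.1)) (ltsLift R.1)) ∧
      (∀ (p q r s : ℕ) (P : LTSCochain K p M L) (Q : LTSCochain K q M L)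
          (R : LTSCochain K r M L) (S : LTSCochain K s M L),
        ∃ T : LTSCochain K (1 + p + q + r + s) M L,
          l 4 ![of p P, of q Q, of r R, of s S] = of _ T ∧
          ltsLift T.1 = ltsBracket (ltsBracket (ltsBracket (ltsBracket (ltsTwist H)
            (ltsLift P.1)) (ltsLift Q.1)) (ltsLift R.1)) (ltsLift S.1)) ∧
      (∀ k : ℕ, 5 ≤ k → l k = 0) := by
  have h1 := isDeg_curvature hbr hH
  have he := curvature_mem_fil hbr hH
  have h3 := exists_derivedOp_three_eq (Δ := curvature hbr hH) hof hρι (he 3)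
    (represents_semiCoch hbr)
  have h4 := exists_derivedOp_four_eq (Δ := curvature hbr hH) hof hρι (he 4)
    (represents_twistCoch hH)
  refine ⟨derivedOp ι ρ (curvature hbr hH),
    isLInfinityAlgebra_derivedOp hint hι hdeg ?_ ?_ h1 he (bra_curvature hbr hθ hH),
    derivedOp_eq_zero (curvature_eq_zero hbr hH (by decide) (by decide)),
    derivedOp_eq_zero (curvature_eq_zero hbr hH (by decide) (by decide)), fun p q r P Q R => h3 p q r P Q R _ rfl rfl rfl,
    fun p q r s P Q R S => h4 p q r s P Q R S _ rfl rfl rfl rfl, fun k hk =>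
      derivedOp_eq_zero (curvature_eq_zero hbr hH (by omega) (by omega))⟩
  -- Homogeneous elements of `fil 0` lie in the image of `ι`, so the left inverse `ρ` is a two-sided
  -- inverse on them.
  · intro d F hF hd
    obtain ⟨x, -, rfl⟩ := hρ d F hF hd
    rw [hρι]
  · intro d F hF hd
    obtain ⟨x, hx, rfl⟩ := hρ d F hF hd
    rwa [hρι]

end main
theorem mainTheorem2 {K L M : Type*} [Field K] [CharZero K]
    [AddCommGroup L] [Module K L] [AddCommGroup M] [Module K M]
    (br : L →ₗ[K] L →ₗ[K] L →ₗ[K] L) (hbr : IsLieTripleSystem br)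
    (θ : L →ₗ[K] L →ₗ[K] Module.End K M) (hθ : IsLTSRepresentation br θ)
    (H : L →ₗ[K] L →ₗ[K] L →ₗ[K] M) (hH : IsLTSThreeCocycle br θ H) :
    ∃ l : ∀ k : ℕ,
        MultilinearMap K (fun _ : Fin k => LTSCochainSpace K M L) (LTSCochainSpace K M L),
      IsLInfinityAlgebra K (LTSCochainSpace K M L) (ltsGrading K M L) l ∧
      l 1 = 0 ∧
      l 2 = 0 ∧
      (∀ (p q r : ℕ) (P : LTSCochain K p M L) (Q : LTSCochain K q M L) (R : LTSCochain K r M L),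
        ∃ T : LTSCochain K (1 + p + q + r) M L,
          l 3 ![ltsOf P, ltsOf Q, ltsOf R] = ltsOf T ∧
          ltsLift T.1 = ltsBracket (ltsBracket (ltsBracket (ltsSemidirect br θ)
            (ltsLift P.1)) (ltsLift Q.1)) (ltsLift R.1)) ∧
      (∀ (p q r s : ℕ) (P : LTSCochain K p M L) (Q : LTSCochain K q M L)
          (R : LTSCochain K r M L) (S : LTSCochain K s M L),
        ∃ T : LTSCochain K (1 + p + q + r + s) M L,
          l 4 ![ltsOf P, ltsOf Q, ltsOf R, ltsOf S] = ltsOf T ∧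
          ltsLift T.1 = ltsBracket (ltsBracket (ltsBracket (ltsBracket (ltsTwist H)
            (ltsLift P.1)) (ltsLift Q.1)) (ltsLift R.1)) (ltsLift S.1)) ∧
      (∀ k : ℕ, 5 ≤ k → l k = 0) := by
  have key := exists_isLInfinityAlgebra (V := LTSCochainSpace K M L) (𝒜 := ltsGrading K M L)
    (ι := totalLift K L M) (ρ := totalRet K L M) hbr hθ hH
    (by with_reducible_and_instances exact isInternal_ltsGrading) (fun _ => ltsOf)
    (by exact fun n f => totalLift_ltsOf f) (by exact totalLift_mem_fil)
    (by exact fun d x hx => isDeg_totalLift hx) (by exact totalRet_totalLift)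
    (by exact fun d F => exists_totalLift_eq)
  exact key
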